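/- Let $K$ be a field of characteristic $0$, $\Gamma$ a finite abelian group, $H=K[\Gamma]$, and let $W=\bigoplus_{i=1}^{\theta}Kx_i$ be a quantum linear space over $\Gamma$: $x_i$ has degree $g_i\in\Gamma$ and $\Gamma$ acts on it through a character $\chi_i:\Gamma\to K^\times$, where $\chi_i(g_j)\chi_j(g_i)=1$ for $i\ne j$, and $\chi_i(g_i)$ is a primitive $r_i$-th root of unity, $r_i\ge 2$. Let $R=\mathcal B(W)$ be the Nichols algebra of $W$ and $A=R\# H$ its Radford biproduct, so that $hx_i=\chi_i(h)x_ih$ and $\Delta(h)=h\otimes h$ for $h\in\Gamma$, and $\Delta(x_i)=x_i\otimes 1+g_i\otimes x_i$. Let $\pi:A\to H$ be the projection with $\pi(h)=h$, $\pi(x_i)=0$, and let $\lambda:H\to K$ be the total integral, $\lambda(h)=\delta_{h,1}$ for $h\in\Gamma$. For $i\in\{1,\dots,\theta\}$ and $a_i\in K$ with $\chi_i^{r_i}=\varepsilon$, let $\gamma_i:A\otimes A\to K$ be the linear map determined as follows. It is $H$-bilinear, $\gamma_i(hy\otimes zh')=\varepsilon(h)\,\gamma_i(y\otimes z)\,\varepsilon(h')$,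 and $H$-balanced, $\gamma_i(yh\otimes z)=\gamma_i(y\otimes hz)$, for $h,h'\in H$ and $y,z\in A$; and on pairs of monomials $x_1^{n_1}\cdots x_\theta^{n_\theta}\otimes x_1^{m_1}\cdots x_\theta^{m_\theta}$ with $0\le n_j,m_j<r_j$ it equals $\varepsilon\otimes\varepsilon$, except that $\gamma_i(x_i^{k}\otimes x_i^{r_i-k})=a_i$ for $0<k<r_i$. Let $I\subseteq\{1,\dots,\theta\}$, let $a_i\in K$ be such that $\chi_i^{r_i}=\varepsilon$ and $\gamma_i\neq\varepsilon\otimes\varepsilon$ for all $i\in I$, and let $\alpha=\prod_{i\in I}\gamma_i$ be the convolution product, taken in increasing order of the indices. Suppose that $g_{j_1}^{r_{j_1}}\cdots g_{j_t}^{r_{j_t}}\ne 1$ for every nonempty subset $\{j_1,\dots,j_t\}$ of $I$ (with $j_1,\dots,j_t$ distinct). Then the maps $\gamma_i$, $i\in I$, exist, $\alpha$ is convolution invertible, and for the multiplication $m_B=\alpha * m_A * \alpha^{-1}$ of the twist $B=A^{\alpha}$ one has $$\lambda\circ\pi\circ m_B=\alpha_R\quad\text{on } R\otimes R,$$ where $\alpha_R$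 is the restriction of $\alpha$ to $R\otimes R$. -/

import Mathlib

open scoped TensorProduct

noncomputable section

/-- A quantum linear space `W = ⊕ K x_i` over a group `Γ`: the vector `x_i` has degree `g i` and
`Γ` acts on it through the character `χ i`; distinct `i, j` satisfy `χ_i(g_j) χ_j(g_i) = 1`, and
`χ_i(g_i)` is a primitive `r_i`-th root of unity, `r_i ≥ 2`. -/
structure QuantumLinearSpace (K : Type*) [Field K] (Γ : Type*) [CommGroup Γ] (θ : ℕ) where
  g : Fin θ → Γ
  χ : Fin θ → Γ →* Kˣ
  r : Fin θ → ℕ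
  braiding : ∀ i j, i ≠ j → χ i (g j) * χ j (g i) = 1
  two_le : ∀ i, 2 ≤ r i
  primitive : ∀ i, IsPrimitiveRoot (χ i (g i)) (r i)

namespace QuantumLinearSpace

variable {K : Type*} [Field K] {Γ : Type*} [CommGroup Γ] {θ : ℕ} (W : QuantumLinearSpace K Γ θ)

/-! ### The bosonization `T(W) # K[Γ]` of the tensor algebra -/

/-- The relations of the smash product `T(W) # K[Γ]` between the generators `h ∈ Γ` and
`x_1, …, x_θ`: those of the group `Γ`, and `h x_i = χ_i(h) x_i h`. -/
inductive Rel : FreeAlgebra K (Γ ⊕ Fin θ) → FreeAlgebra K (Γ ⊕ Fin θ) → Prop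
  | one : Rel (FreeAlgebra.ι K (Sum.inl 1)) 1
  | mul (h k : Γ) : Rel (FreeAlgebra.ι K (Sum.inl h) * FreeAlgebra.ι K (Sum.inl k))
      (FreeAlgebra.ι K (Sum.inl (h * k)))
  | comm (h : Γ) (i : Fin θ) : Rel (FreeAlgebra.ι K (Sum.inl h) * FreeAlgebra.ι K (Sum.inr i))
      ((W.χ i h : K) • (FreeAlgebra.ι K (Sum.inr i) * FreeAlgebra.ι K (Sum.inl h)))

/-- The algebra `T(W) # K[Γ]`. -/
abbrev TensorBoson : Type _ := RingQuot W.Rel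

/-- The element `h ∈ Γ` of `T(W) # K[Γ]`. -/
def tGrp (h : Γ) : W.TensorBoson := RingQuot.mkAlgHom K W.Rel (FreeAlgebra.ι K (Sum.inl h))

/-- The element `x_i` of `T(W) # K[Γ]`. -/
def tX (i : Fin θ) : W.TensorBoson := RingQuot.mkAlgHom K W.Rel (FreeAlgebra.ι K (Sum.inr i))

theorem tGrp_one : W.tGrp 1 = 1 := by
  simpa [tGrp] using RingQuot.mkAlgHom_rel K (Rel.one (W := W))

theorem tGrp_mul (h k : Γ) : W.tGrp (h * k) = W.tGrp h * W.tGrp k := by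
  simpa [tGrp] using (RingQuot.mkAlgHom_rel K (Rel.mul (W := W) h k)).symm

theorem tGrp_mul_tX (h : Γ) (i : Fin θ) :
    W.tGrp h * W.tX i = (W.χ i h : K) • (W.tX i * W.tGrp h) := by
  simpa [tGrp, tX] using RingQuot.mkAlgHom_rel K (Rel.comm (W := W) h i)

/-- An algebra homomorphism out of `T(W) # K[Γ]`, given on the generators. -/
def tLift {B : Type*} [Semiring B] [Algebra K B] (G : Γ → B) (X : Fin θ → B) (h1 : G 1 = 1)
    (hm : ∀ h k, G h * G k = G (h * k))
    (hc : ∀ h i, G h * X i = (W.χ i h : K) • (X i * G h)) : W.TensorBoson →ₐ[K] B :=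
  RingQuot.liftAlgHom K ⟨FreeAlgebra.lift K (Sum.elim G X), by
    intro a b hab
    cases hab with
    | one => simpa using h1
    | mul h k => simpa using hm h k
    | comm h i => simpa using hc h i⟩

section lift
variable {B : Type*} [Semiring B] [Algebra K B] (G : Γ → B) (X : Fin θ → B) (h1 : G 1 = 1)
    (hm : ∀ h k, G h * G k = G (h * k))
    (hc : ∀ h i, G h * X i = (W.χ i h : K) • (X i * G h))

@[simp] theorem tLift_tGrp (h : Γ) : W.tLift G X h1 hm hc (W.tGrp h) = G h := by
  simp [tLift, tGrp]

@[simp] theorem tLift_tX (i : Fin θ) : W.tLift G X h1 hm hc (W.tX i) = X i := by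
  simp [tLift, tX]

end lift

theorem tHom_ext {B : Type*} [Semiring B] [Algebra K B] {f f' : W.TensorBoson →ₐ[K] B}
    (hG : ∀ h, f (W.tGrp h) = f' (W.tGrp h)) (hX : ∀ i, f (W.tX i) = f' (W.tX i)) : f = f' := by
  apply RingQuot.ringQuot_ext'
  apply FreeAlgebra.hom_ext
  funext s
  rcases s with h | i
  · exact hG h
  · exact hX i

theorem tComul_aux_one : W.tGrp 1 ⊗ₜ[K] W.tGrp 1 = 1 := by
  rw [tGrp_one, Algebra.TensorProduct.one_def]

theorem tComul_aux_mul (h k : Γ) :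
    (W.tGrp h ⊗ₜ[K] W.tGrp h) * (W.tGrp k ⊗ₜ[K] W.tGrp k) =
      W.tGrp (h * k) ⊗ₜ[K] W.tGrp (h * k) := by
  rw [Algebra.TensorProduct.tmul_mul_tmul, tGrp_mul]

theorem tComul_aux_comm (h : Γ) (i : Fin θ) :
    (W.tGrp h ⊗ₜ[K] W.tGrp h) * (W.tX i ⊗ₜ[K] 1 + W.tGrp (W.g i) ⊗ₜ[K] W.tX i) =
      (W.χ i h : K) •
        ((W.tX i ⊗ₜ[K] 1 + W.tGrp (W.g i) ⊗ₜ[K] W.tX i) * (W.tGrp h ⊗ₜ[K] W.tGrp h)) := by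
  have hcomm : W.tGrp h * W.tGrp (W.g i) = W.tGrp (W.g i) * W.tGrp h := by
    rw [← tGrp_mul, ← tGrp_mul, mul_comm]
  simp only [mul_add, add_mul, Algebra.TensorProduct.tmul_mul_tmul, tGrp_mul_tX, hcomm,
    mul_one, one_mul, smul_add, TensorProduct.smul_tmul', TensorProduct.tmul_smul]

/-- The comultiplication of `T(W) # K[Γ]`: `Δ(h) = h ⊗ h` and `Δ(x_i) = x_i ⊗ 1 + g_i ⊗ x_i`. -/
def tComul : W.TensorBoson →ₐ[K] W.TensorBoson ⊗[K] W.TensorBoson :=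
  W.tLift (fun h => W.tGrp h ⊗ₜ[K] W.tGrp h)
    (fun i => W.tX i ⊗ₜ[K] 1 + W.tGrp (W.g i) ⊗ₜ[K] W.tX i)
    W.tComul_aux_one W.tComul_aux_mul W.tComul_aux_comm

/-- The counit of `T(W) # K[Γ]`: `ε(h) = 1` and `ε(x_i) = 0`. -/
def tCounit : W.TensorBoson →ₐ[K] K :=
  W.tLift (fun _ => 1) (fun _ => 0) rfl (by simp) (by simp)

theorem tComul_tGrp (h : Γ) : W.tComul (W.tGrp h) = W.tGrp h ⊗ₜ[K] W.tGrp h :=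
  W.tLift_tGrp _ _ W.tComul_aux_one W.tComul_aux_mul W.tComul_aux_comm h

theorem tComul_tX (i : Fin θ) :
    W.tComul (W.tX i) = W.tX i ⊗ₜ[K] 1 + W.tGrp (W.g i) ⊗ₜ[K] W.tX i :=
  W.tLift_tX _ _ W.tComul_aux_one W.tComul_aux_mul W.tComul_aux_comm i

theorem tCounit_tGrp (h : Γ) : W.tCounit (W.tGrp h) = 1 := by rw [tCounit, tLift_tGrp]

theorem tCounit_tX (i : Fin θ) : W.tCounit (W.tX i) = 0 := by rw [tCounit, tLift_tX]

instance : Bialgebra K W.TensorBoson :=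
  Bialgebra.ofAlgHom W.tComul W.tCounit
    (by
      apply W.tHom_ext
      · intro h; simp [tComul_tGrp]
      · intro i
        simp [tComul_tX, tComul_tGrp, TensorProduct.add_tmul, TensorProduct.tmul_add,
          Algebra.TensorProduct.one_def, add_assoc])
    (by
      apply W.tHom_ext
      · intro h; simp [tComul_tGrp, tCounit_tGrp]
      · intro i; simp [tComul_tX, tCounit_tX, tCounit_tGrp])
    (by
      apply W.tHom_ext
      · intro h; simp [tComul_tGrp, tCounit_tGrp]
      · intro i; simp [tComul_tX, tCounit_tX])

/-- The projection `T(W) # K[Γ] → K[Γ]`, `h ↦ h`, `x_i ↦ 0`. -/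
def tProj : W.TensorBoson →ₐ[K] MonoidAlgebra K Γ :=
  W.tLift (fun h => MonoidAlgebra.of K Γ h) (fun _ => 0) (map_one _)
    (by intro h k; exact (map_mul _ h k).symm) (by simp)

/-! ### The Nichols algebra `R = 𝓑(W)` and its Radford biproduct `A = R # K[Γ]` -/

/-- A biideal of `T(W) # K[Γ]` (two-sided ideal and coideal) all of whose elements have degree at
least two in the `x_i`; the kernel of the projection to `K[Γ]` is the part of degree at least one,
so its square is the part of degree at least two. -/
def IsNicholsBiideal (I : Ideal W.TensorBoson) : Prop :=
  I.IsTwoSided ∧ (I.restrictScalars K).IsCoideal ∧ I ≤ RingHom.ker W.tProj ^ 2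

/-- The largest biideal of `T(W) # K[Γ]` that is contained in the part of degree at least two. -/
def nicholsIdeal : Ideal W.TensorBoson := sSup {I | W.IsNicholsBiideal I}

instance : W.nicholsIdeal.IsTwoSided := by
  constructor
  intro a b ha
  have hle : W.nicholsIdeal ≤
      Submodule.comap (LinearMap.toSpanSingleton W.TensorBoson W.TensorBoson b)
        W.nicholsIdeal := by
    refine sSup_le fun I hI x hx => ?_
    have := hI.1
    exact le_sSup (a := I) hI (I.mul_mem_right b hx)
  exact hle ha

instance : (W.nicholsIdeal.restrictScalars K).IsCoideal where
  counit_eq_zero := by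
    have hle : W.nicholsIdeal ≤ RingHom.ker (Bialgebra.counitAlgHom K W.TensorBoson) :=
      sSup_le fun I hI x hx => hI.2.1.counit_eq_zero hx
    exact fun x hx => hle hx
  map_mkQ_comul_eq_zero := by
    have hle : W.nicholsIdeal ≤ RingHom.ker ((Algebra.TensorProduct.map
        (Ideal.Quotient.mkₐ K W.nicholsIdeal) (Ideal.Quotient.mkₐ K W.nicholsIdeal)).comp
        (Bialgebra.comulAlgHom K W.TensorBoson)) := by
      refine sSup_le fun I hI x hx => ?_
      have h0 := hI.2.1.map_mkQ_comul_eq_zero hx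
      have hIJ : I.restrictScalars K ≤ W.nicholsIdeal.restrictScalars K :=
        fun y hy => le_sSup (a := I) hI hy
      have h1 := congrArg (TensorProduct.map (Submodule.factor hIJ) (Submodule.factor hIJ)) h0
      rw [← LinearMap.comp_apply, ← TensorProduct.map_comp, map_zero] at h1
      exact h1
    exact fun x hx => hle hx

/-- The Radford biproduct `A = 𝓑(W) # K[Γ]` of the Nichols algebra of `W` with `K[Γ]`: the quotient
of `T(W) # K[Γ]` by its largest biideal contained in degrees at least two. It is a bialgebra. -/
abbrev A : Type _ := W.TensorBoson ⧸ W.nicholsIdeal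

/-- The element `x_i` of `A`. -/
def x (i : Fin θ) : W.A := Ideal.Quotient.mk W.nicholsIdeal (W.tX i)

/-- The inclusion of `H = K[Γ]` into `A`. -/
def incl : MonoidAlgebra K Γ →ₐ[K] W.A :=
  MonoidAlgebra.lift K W.A Γ
    { toFun := fun h => Ideal.Quotient.mk W.nicholsIdeal (W.tGrp h)
      map_one' := by rw [tGrp_one, map_one]
      map_mul' := fun h k => by rw [tGrp_mul, map_mul] }

theorem nicholsIdeal_le_ker_tProj : W.nicholsIdeal ≤ RingHom.ker W.tProj :=
  sSup_le fun _ hI => hI.2.2.trans (Ideal.pow_le_self two_ne_zero)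

/-- The projection `π : A → H = K[Γ]`, `h ↦ h`, `x_i ↦ 0`, that is, `ε_R ⊗ id_H`. -/
def proj : W.A →ₐ[K] MonoidAlgebra K Γ :=
  Ideal.Quotient.liftₐ W.nicholsIdeal W.tProj fun _ ha => W.nicholsIdeal_le_ker_tProj ha

/-- The Nichols algebra `R = 𝓑(W)` inside `A = R # H`: the subalgebra generated by `W`. -/
def nichols : Subalgebra K W.A := Algebra.adjoin K (Set.range W.x)

/-- The inclusion `R ⊗ R → A ⊗ A`. -/
def nicholsIncl : W.nichols ⊗[K] W.nichols →ₗ[K] W.A ⊗[K] W.A :=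
  TensorProduct.map W.nichols.val.toLinearMap W.nichols.val.toLinearMap

/-- The monomial `x_1 ^ n_1 ⋯ x_θ ^ n_θ` of `A`. -/
def mono (n : Fin θ → ℕ) : W.A := (List.ofFn fun i => W.x i ^ n i).prod

/-- The total integral `λ` on `K[Γ]`: `λ(h) = δ_{h,1}` for `h ∈ Γ`. -/
def integral (K Γ : Type*) [Field K] [CommGroup Γ] : MonoidAlgebra K Γ →ₗ[K] K :=
  Finsupp.lapply 1 ∘ₗ (MonoidAlgebra.coeffLinearEquiv K).toLinearMap

/-! ### The maps `γ_i`, and the twist of the multiplication of `A`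

Linear maps `A ⊗ A → K` and `A ⊗ A → A` are multiplied by convolution, in `WithConv _`. -/

/-- `γ : A ⊗ A → K` is the map `γ_i` with parameter `a`: it is `H`-bilinear and `H`-balanced, and on
pairs of monomials `x_1 ^ n_1 ⋯ x_θ ^ n_θ`, `n_j < r_j`, it agrees with `ε ⊗ ε` except that
`γ(x_i ^ k ⊗ x_i ^ (r_i - k)) = a` for `0 < k < r_i`. -/
structure IsGamma (i : Fin θ) (a : K) (γ : W.A ⊗[K] W.A →ₗ[K] K) : Prop where
  left : ∀ (h : MonoidAlgebra K Γ) (y z : W.A),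
    γ ((W.incl h * y) ⊗ₜ z) = Coalgebra.counit (R := K) h * γ (y ⊗ₜ z)
  right : ∀ (h : MonoidAlgebra K Γ) (y z : W.A),
    γ (y ⊗ₜ (z * W.incl h)) = γ (y ⊗ₜ z) * Coalgebra.counit (R := K) h
  balanced : ∀ (h : MonoidAlgebra K Γ) (y z : W.A),
    γ ((y * W.incl h) ⊗ₜ z) = γ (y ⊗ₜ (W.incl h * z))
  exceptional : ∀ k, 0 < k → k < W.r i → γ ((W.x i ^ k) ⊗ₜ (W.x i ^ (W.r i - k))) = a
  trivial : ∀ n m : Fin θ → ℕ, (∀ j, n j < W.r j) → (∀ j, m j < W.r j) →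
    (¬ ∃ k, 0 < k ∧ k < W.r i ∧ n = Pi.single i k ∧ m = Pi.single i (W.r i - k)) →
    γ (W.mono n ⊗ₜ W.mono m) =
      Coalgebra.counit (R := K) (W.mono n) * Coalgebra.counit (R := K) (W.mono m)

open Classical in
/-- The map `γ_i : A ⊗ A → K` with parameter `a`. It is determined by the conditions `IsGamma`, since
the `x_1 ^ n_1 ⋯ x_θ ^ n_θ h`, with `n_j < r_j` and `h ∈ Γ`, span `A`; it is `0` by convention if
no map satisfies them. -/
def gamma (i : Fin θ) (a : K) : WithConv (W.A ⊗[K] W.A →ₗ[K] K) :=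
  if h : ∃ γ, W.IsGamma i a γ then WithConv.toConv h.choose else 0

/-- The convolution product `α = ∏_{i ∈ I} γ_i`, in increasing order of the indices, where `γ_i` has
parameter `a_i`. -/
def alpha (a : Fin θ → K) (I : Finset (Fin θ)) : WithConv (W.A ⊗[K] W.A →ₗ[K] K) :=
  ((I.sort (· ≤ ·)).map fun i => W.gamma i (a i)).prod

/-- The multiplication `m_B = α * m_A * α⁻¹` (convolution products in `Hom(A ⊗ A, A)`) of the twist
`B = A^α` of `A`, on the same underlying coalgebra as `A`. -/
def twistedMul (α : WithConv (W.A ⊗[K] W.A →ₗ[K] K)) : W.A ⊗[K] W.A →ₗ[K] W.A :=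
  (WithConv.toConv (Algebra.linearMap K W.A ∘ₗ α.ofConv) *
    WithConv.toConv (LinearMap.mul' K W.A) *
    WithConv.toConv (Algebra.linearMap K W.A ∘ₗ (Ring.inverse α).ofConv)).ofConv

end QuantumLinearSpace

end

/-! Everything takes place in the convolution algebras of maps on `A` and on `A ⊗ A`.

Invertibility. Let `q_i = χ_i(g_i)`, and let `d_i = der i` be the skew derivation dual to `x_i`. It
satisfies `χ_i * d_i = q_i (d_i * χ_i)`, so on monomials the power `d_i ^ k` detects exactly `x_i ^
k`, with value the quantum factorial `(k)!`, and `d_i ^ r_i = 0`. Hence `γ_i = 1 + a_i η_i`, where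
`η_i` is the sum over `0 < k < r_i` of `d_i ^ k χ_i ^ (r_i - k) ⊗ d_i ^ (r_i - k)` divided by `(k)!
(r_i - k)!` (`isGamma_one_add_smul_eta`, `gamma_eq`). In each term of `η_i * η_i` some power of
`d_i` reaches `r_i`, so `η_i * η_i = 0` and `γ_i` has inverse `1 - a_i η_i`.

The formula. Let `P = π ∘ m`, a map from `A ⊗ A` to `K[Γ]`. Then `λ ∘ π ∘ m_B = α * (λ ∘ P) * α⁻¹`.
Elements of `R` are coinvariant under `π`, so `ψ * P` restricts to `ψ · 1` on `R ⊗ R` for every form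
`ψ`. Moreover `π * d_i = g_i (d_i * π)`, whence `P * η_i = g_i ^ r_i (η_i * P)`. Expanding `α⁻¹`
gives `1` plus forms of degree `k = ∏ j ∈ J, g_j ^ r_j` with `J ⊆ I` nonempty
(`exists_inverse_prod`). The term `1` contributes `α`. A form of degree `k` contributes `λ` of
scalar multiples of `k`, which is zero because `k ≠ 1`. -/

noncomputable section

/-! ### Quantum integers and the quantum binomial formula -/

section QuantumBinomial

variable {K : Type*} [Field K]

/-- The quantum integer `(n)_q = 1 + q + ⋯ + q ^ (n - 1)`. -/
def qInt (q : K) (n : ℕ) : K := ∑ i ∈ Finset.range n, q ^ i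

/-- The quantum factorial `(1)_q (2)_q ⋯ (n)_q`. -/
def qFactorial (q : K) (n : ℕ) : K := ∏ i ∈ Finset.range n, qInt q (i + 1)

/-- The quantum binomial coefficient `(k + l)_q! / ((k)_q! (l)_q!)`, by Pascal's rule. -/
def qBinom (q : K) : ℕ → ℕ → K
  | 0, _ => 1
  | _ + 1, 0 => 1
  | k + 1, l + 1 => qBinom q k (l + 1) + q ^ (k + 1) * qBinom q (k + 1) l

theorem qInt_succ (q : K) (n : ℕ) : qInt q (n + 1) = q * qInt q n + 1 := by
  simp only [qInt, Finset.sum_range_succ', pow_succ', pow_zero, Finset.mul_sum]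

theorem qInt_add (q : K) (m n : ℕ) : qInt q (m + n) = qInt q m + q ^ m * qInt q n := by
  simp only [qInt, Finset.sum_range_add, pow_add, Finset.mul_sum]

theorem qFactorial_zero (q : K) : qFactorial q 0 = 1 := by simp [qFactorial]

theorem qFactorial_succ (q : K) (n : ℕ) :
    qFactorial q (n + 1) = qFactorial q n * qInt q (n + 1) := by
  rw [qFactorial, Finset.prod_range_succ, ← qFactorial]

theorem qBinom_zero_left (q : K) (l : ℕ) : qBinom q 0 l = 1 := by simp [qBinom]

theorem qBinom_zero_right (q : K) (k : ℕ) : qBinom q k 0 = 1 := by cases k <;> simp [qBinom]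

/-- Pascal's rule matches `(k + l + 2)_q = (k + 1)_q + q ^ (k + 1) (l + 1)_q`. The form without
division stays meaningful at roots of unity, where factorials vanish. -/
theorem qBinom_mul_qFactorial (q : K) (k l : ℕ) :
    qBinom q k l * (qFactorial q k * qFactorial q l) = qFactorial q (k + l) := by
  induction k generalizing l with
  | zero => simp [qBinom_zero_left, qFactorial_zero]
  | succ k ihk =>
    induction l with
    | zero => simp [qBinom_zero_right, qFactorial_zero]
    | succ l ihl =>
      have h1 := ihk (l + 1)
      have h2 : qFactorial q (k + 1 + (l + 1)) =
          qFactorial q (k + (l + 1)) * (qInt q (k + 1) + q ^ (k + 1) * qInt q (l + 1)) := by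
        rw [← qInt_add, show k + 1 + (l + 1) = (k + (l + 1)) + 1 by ring, qFactorial_succ]
      rw [show k + 1 + l = k + (l + 1) by ring] at ihl
      rw [h2, qBinom]
      rw [qFactorial_succ q k] at ihl ⊢
      rw [qFactorial_succ q l] at h1 ⊢
      linear_combination (q ^ (k + 1) * qInt q (l + 1)) * ihl + qInt q (k + 1) * h1

theorem qInt_eq_zero {q : K} {r : ℕ} (hq : IsPrimitiveRoot q r) (hr : 2 ≤ r) : qInt q r = 0 :=
  hq.geom_sum_eq_zero hr

theorem qInt_ne_zero {q : K} {r : ℕ} (hq : IsPrimitiveRoot q r) {n : ℕ} (h0 : 0 < n)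
    (hn : n < r) : qInt q n ≠ 0 := by
  intro h
  have := mul_geom_sum q n
  rw [← qInt, h, mul_zero] at this
  exact hq.pow_ne_one_of_pos_of_lt h0.ne' hn (sub_eq_zero.1 this.symm)

theorem qFactorial_ne_zero {q : K} {r : ℕ} (hq : IsPrimitiveRoot q r) {n : ℕ} (hn : n < r) :
    qFactorial q n ≠ 0 :=
  Finset.prod_ne_zero_iff.2 fun i hi =>
    qInt_ne_zero hq i.succ_pos (by have := Finset.mem_range.1 hi; omega)

theorem qFactorial_eq_zero {q : K} {r : ℕ} (hq : IsPrimitiveRoot q r) (hr : 2 ≤ r) :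
    qFactorial q r = 0 := by
  obtain ⟨n, rfl⟩ : ∃ n, r = n + 1 := ⟨r - 1, by omega⟩
  rw [qFactorial_succ, qInt_eq_zero hq hr, mul_zero]

/-- The factorial of `r` contains `(r)_q = 0`, while those of `k, l < r` are nonzero. -/
theorem qBinom_eq_zero {q : K} {r : ℕ} (hq : IsPrimitiveRoot q r) {k l : ℕ} (hkl : k + l = r)
    (hk : k ≠ 0) (hl : l ≠ 0) : qBinom q k l = 0 := by
  have h := qBinom_mul_qFactorial q k l
  rw [hkl, qFactorial_eq_zero hq (by omega)] at h
  exact (mul_eq_zero.1 h).resolve_right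
    (mul_ne_zero (qFactorial_ne_zero hq (by omega)) (qFactorial_ne_zero hq (by omega)))

theorem mul_pow_of_qcomm {B : Type*} [Ring B] [Algebra K B] {q : K} {X Y : B}
    (h : Y * X = q • (X * Y)) (n : ℕ) : Y * X ^ n = q ^ n • (X ^ n * Y) := by
  induction n with
  | zero => simp
  | succ n ih =>
    rw [pow_succ, ← mul_assoc, ih, smul_mul_assoc, mul_assoc, h, mul_smul_comm, smul_smul,
      ← pow_succ, mul_assoc]

theorem add_pow_of_qcomm {B : Type*} [Ring B] [Algebra K B] {q : K} {X Y : B}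
    (h : Y * X = q • (X * Y)) (n : ℕ) :
    (X + Y) ^ n = ∑ p ∈ Finset.HasAntidiagonal.antidiagonal n,
      qBinom q p.1 p.2 • (X ^ p.1 * Y ^ p.2) := by
  induction n with
  | zero => simp [qBinom]
  | succ n ih =>
    -- `F` collects the terms of `X * (X + Y) ^ n`, and `G` those of `Y * (X + Y) ^ n`, where moving
    -- `Y` past `X ^ k` costs `q ^ k`. Their sum is Pascal's rule.
    let F : ℕ × ℕ → B := fun p => match p with
      | (0, _) => 0
      | (k + 1, l) => qBinom q k l • (X ^ (k + 1) * Y ^ l)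
    let G : ℕ × ℕ → B := fun p => match p with
      | (_, 0) => 0
      | (k, l + 1) => (q ^ k * qBinom q k l) • (X ^ k * Y ^ (l + 1))
    have hFG : ∀ p ∈ Finset.HasAntidiagonal.antidiagonal (n + 1),
        qBinom q p.1 p.2 • (X ^ p.1 * Y ^ p.2) = F p + G p := by
      rintro ⟨_ | k, _ | l⟩ hp
      · simp at hp
      · simp [F, G, qBinom_zero_left]
      · simp [F, G, qBinom_zero_right]
      · simp [F, G, qBinom, add_smul]
    rw [Finset.sum_congr rfl hFG, Finset.sum_add_distrib, Finset.Nat.sum_antidiagonal_succ,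
      Finset.Nat.sum_antidiagonal_succ' (f := G), pow_succ', ih, add_mul, Finset.mul_sum,
      Finset.mul_sum]
    simp only [F, G, zero_add]
    congr 1
    · refine Finset.sum_congr rfl fun p _ => ?_
      rw [mul_smul_comm, ← mul_assoc, ← pow_succ']
    · refine Finset.sum_congr rfl fun p _ => ?_
      rw [mul_smul_comm, ← mul_assoc, mul_pow_of_qcomm h, smul_mul_assoc, smul_smul, mul_assoc,
        ← pow_succ', mul_comm]

/-- The quantum binomial formula at a primitive root of unity. -/
theorem add_pow_of_qcomm_of_isPrimitiveRoot {B : Type*} [Ring B] [Algebra K B] {q : K} {X Y : B}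
    (h : Y * X = q • (X * Y)) {r : ℕ} (hq : IsPrimitiveRoot q r) (hr : r ≠ 0) :
    (X + Y) ^ r = X ^ r + Y ^ r := by
  obtain ⟨n, rfl⟩ := Nat.exists_eq_succ_of_ne_zero hr
  rw [add_pow_of_qcomm h]
  have hne : ((0, n + 1) : ℕ × ℕ) ≠ (n + 1, 0) := by simp
  rw [← Finset.sum_subset (s₁ := {(0, n + 1), (n + 1, 0)}), Finset.sum_pair hne]
  · simp [qBinom_zero_left, qBinom_zero_right, add_comm]
  · intro p hp
    simp only [Finset.mem_insert, Finset.mem_singleton] at hp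
    rcases hp with rfl | rfl <;> simp
  · rintro ⟨k, l⟩ hp hp'
    rw [Finset.HasAntidiagonal.mem_antidiagonal] at hp
    simp only [Finset.mem_insert, Finset.mem_singleton, Prod.mk.injEq] at hp'
    simp only at hp
    rw [qBinom_eq_zero hq hp (by omega) (by omega), zero_smul]

end QuantumBinomial

/-! ### The relations of `A` and its spanning monomials -/

namespace QuantumLinearSpace

variable {K : Type*} [Field K] {Γ : Type*} [CommGroup Γ] {θ : ℕ} (W : QuantumLinearSpace K Γ θ)

theorem tAdjoin_eq_top :
    Algebra.adjoin K (Set.range W.tGrp ∪ Set.range W.tX) = ⊤ := by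
  have h : Set.range W.tGrp ∪ Set.range W.tX =
      RingQuot.mkAlgHom K W.Rel '' Set.range (FreeAlgebra.ι K) := by
    rw [← Set.range_comp, ← Set.Sum.elim_range]
    congr 1
    funext s
    rcases s with s | s <;> rfl
  rw [h, ← AlgHom.map_adjoin, FreeAlgebra.adjoin_range_ι, Algebra.map_top]
  exact (AlgHom.range_eq_top _).2 (RingQuot.mkAlgHom_surjective K W.Rel)

/-- A subspace of an algebra that contains `1` and is stable under right multiplication by a set
contains the subalgebra that the set generates. -/
theorem adjoin_le_of_mul_right {B : Type*} [Semiring B] [Algebra K B] {s : Set B}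
    {p : Submodule K B} (h1 : (1 : B) ∈ p) (hs : ∀ y ∈ p, ∀ b ∈ s, y * b ∈ p) {y : B}
    (hy : y ∈ Algebra.adjoin K s) : y ∈ p := by
  suffices h : ∀ z ∈ p, z * y ∈ p by simpa using h 1 h1
  induction hy using Algebra.adjoin_induction with
  | mem b hb => exact fun z hz => hs z hz b hb
  | algebraMap c =>
    intro z hz
    rw [← Algebra.commutes, ← Algebra.smul_def]
    exact p.smul_mem c hz
  | add a b _ _ ha hb =>
    intro z hz
    rw [mul_add]
    exact p.add_mem (ha z hz) (hb z hz)
  | mul a b _ _ ha hb =>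
    intro z hz
    rw [← mul_assoc]
    exact hb _ (ha z hz)

theorem tInduction {p : Submodule K W.TensorBoson} (h1 : 1 ∈ p)
    (hG : ∀ y ∈ p, ∀ h, y * W.tGrp h ∈ p) (hX : ∀ y ∈ p, ∀ i, y * W.tX i ∈ p)
    (y : W.TensorBoson) : y ∈ p := by
  refine adjoin_le_of_mul_right h1 ?_ (W.tAdjoin_eq_top ▸ Algebra.mem_top)
  rintro y hy b (⟨h, rfl⟩ | ⟨i, rfl⟩)
  exacts [hG y hy h, hX y hy i]

/-- The element `h ∈ Γ` of `A`. -/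
def grp (h : Γ) : W.A := Ideal.Quotient.mk W.nicholsIdeal (W.tGrp h)

theorem incl_single (h : Γ) (c : K) : W.incl (MonoidAlgebra.single h c) = c • W.grp h := by
  simp [incl, grp]

theorem incl_of (h : Γ) : W.incl (MonoidAlgebra.of K Γ h) = W.grp h := by
  simp [incl, grp]

theorem grp_one : W.grp 1 = 1 := by rw [grp, tGrp_one, map_one]

theorem grp_mul (h k : Γ) : W.grp (h * k) = W.grp h * W.grp k := by
  rw [grp, tGrp_mul, map_mul]; rfl

theorem grp_mul_x (h : Γ) (i : Fin θ) :
    W.grp h * W.x i = (W.χ i h : K) • (W.x i * W.grp h) :=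
  congrArg (Ideal.Quotient.mkₐ K W.nicholsIdeal) (W.tGrp_mul_tX h i)

theorem induction_right {p : Submodule K W.A} (h1 : 1 ∈ p)
    (hG : ∀ y ∈ p, ∀ h, y * W.grp h ∈ p) (hX : ∀ y ∈ p, ∀ i, y * W.x i ∈ p)
    (y : W.A) : y ∈ p := by
  obtain ⟨t, rfl⟩ := Ideal.Quotient.mk_surjective y
  refine W.tInduction (p := p.comap (Ideal.Quotient.mkₐ K W.nicholsIdeal).toLinearMap) ?_ ?_ ?_ t
  · exact h1
  · exact fun y hy h => hG _ hy h
  · exact fun y hy i => hX _ hy i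

theorem comul_grp (h : Γ) : Coalgebra.comul (R := K) (W.grp h) = W.grp h ⊗ₜ W.grp h :=
  congrArg (TensorProduct.map (Ideal.Quotient.mkₐ K W.nicholsIdeal).toLinearMap
    (Ideal.Quotient.mkₐ K W.nicholsIdeal).toLinearMap) (W.tComul_tGrp h)

theorem comul_x (i : Fin θ) :
    Coalgebra.comul (R := K) (W.x i) = W.x i ⊗ₜ 1 + W.grp (W.g i) ⊗ₜ W.x i :=
  (congrArg (TensorProduct.map (Ideal.Quotient.mkₐ K W.nicholsIdeal).toLinearMap
    (Ideal.Quotient.mkₐ K W.nicholsIdeal).toLinearMap) (W.tComul_tX i)).trans (by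
      rw [map_add]; rfl)

theorem counit_grp (h : Γ) : Coalgebra.counit (R := K) (W.grp h) = 1 := W.tCounit_tGrp h

theorem counit_x (i : Fin θ) : Coalgebra.counit (R := K) (W.x i) = 0 := W.tCounit_tX i

theorem tProj_tGrp (h : Γ) : W.tProj (W.tGrp h) = MonoidAlgebra.of K Γ h := by
  rw [tProj, tLift_tGrp]

theorem tProj_tX (i : Fin θ) : W.tProj (W.tX i) = 0 := by
  rw [tProj, tLift_tX]

theorem proj_grp (h : Γ) : W.proj (W.grp h) = MonoidAlgebra.of K Γ h := W.tProj_tGrp h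

theorem proj_x (i : Fin θ) : W.proj (W.x i) = 0 := W.tProj_tX i

/-- An algebra homomorphism out of `T(W) # K[Γ]` that kills the `x_i` factors through `K[Γ]`. -/
theorem tHom_eq_zero {B : Type*} [Semiring B] [Algebra K B] {f : W.TensorBoson →ₐ[K] B}
    (hf : ∀ i, f (W.tX i) = 0) {y : W.TensorBoson} (hy : W.tProj y = 0) : f y = 0 := by
  let F : MonoidAlgebra K Γ →ₐ[K] B := MonoidAlgebra.lift K B Γ
    { toFun := fun h => f (W.tGrp h)
      map_one' := by rw [tGrp_one, map_one]
      map_mul' := fun h k => by rw [tGrp_mul, map_mul] }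
  have h : f = F.comp W.tProj := by
    apply W.tHom_ext
    · intro h; simp [tProj_tGrp, F]
    · intro i; simp [tProj_tX, hf]
  rw [h, AlgHom.comp_apply, hy, map_zero]

theorem tX_mem_ker (i : Fin θ) : W.tX i ∈ RingHom.ker W.tProj := W.tProj_tX i

/-- Skew-primitive elements of degree at least two vanish in `A`. -/
theorem mk_eq_zero_of_skewPrimitive {s : W.TensorBoson} {k : Γ}
    (hs : s ∈ RingHom.ker W.tProj ^ 2)
    (hΔ : W.tComul s = s ⊗ₜ 1 + W.tGrp k ⊗ₜ s) :
    Ideal.Quotient.mk W.nicholsIdeal s = 0 := by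
  -- The two-sided ideal generated by `s` is itself a biideal in degrees at least two, hence lies in
  -- the largest one. It is a coideal since `s` is a factor of each term of `Δ(s)` and `Δ` is
  -- multiplicative.
  let I : Ideal W.TensorBoson := Ideal.span {y | ∃ a b, y = a * s * b}
  have hsI : s ∈ I := Ideal.subset_span ⟨1, 1, by simp⟩
  have h2 : I.IsTwoSided := by
    constructor
    intro a b ha
    induction ha using Submodule.span_induction with
    | mem y hy =>
      obtain ⟨c, d, rfl⟩ := hy
      exact Ideal.subset_span ⟨c, d * b, by rw [mul_assoc]⟩
    | zero => simp
    | add y z _ _ hy hz => rw [add_mul]; exact I.add_mem hy hz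
    | smul c y _ hy => rw [smul_eq_mul, mul_assoc]; exact I.mul_mem_left c hy
  have hI : I ≤ RingHom.ker W.tProj ^ 2 := by
    refine Ideal.span_le.2 ?_
    rintro _ ⟨a, b, rfl⟩
    exact Ideal.mul_mem_right _ _ (Ideal.mul_mem_left _ _ hs)
  have hco : (I.restrictScalars K).IsCoideal := by
    constructor
    · intro y hy
      refine W.tHom_eq_zero (f := W.tCounit) W.tCounit_tX ?_
      exact Ideal.pow_le_self two_ne_zero (hI hy)
    · intro y hy
      have hle : I ≤ RingHom.ker ((Algebra.TensorProduct.map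
          (Ideal.Quotient.mkₐ K I) (Ideal.Quotient.mkₐ K I)).comp W.tComul) := by
        refine Ideal.span_le.2 ?_
        rintro _ ⟨a, b, rfl⟩
        have h0 : Ideal.Quotient.mk I s = 0 := Ideal.Quotient.eq_zero_iff_mem.2 hsI
        have hs0 : (Algebra.TensorProduct.map
            (Ideal.Quotient.mkₐ K I) (Ideal.Quotient.mkₐ K I)) (W.tComul s) = 0 := by
          rw [hΔ]; simp [h0]
        simp [RingHom.mem_ker, hs0]
      exact hle hy
  exact Ideal.Quotient.eq_zero_iff_mem.2
    (le_sSup (a := I) (show W.IsNicholsBiideal I from ⟨h2, hco, hI⟩) hsI)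

/-- The summands of `Δ(x_i)` commute up to a primitive `r_i`-th root of unity, so the quantum
binomial formula makes `x_i ^ r_i` skew-primitive. -/
theorem x_pow_r (i : Fin θ) : W.x i ^ W.r i = 0 := by
  have hq : IsPrimitiveRoot (W.χ i (W.g i) : K) (W.r i) :=
    IsPrimitiveRoot.coe_units_iff.2 (W.primitive i)
  have hr := W.two_le i
  rw [x, ← map_pow]
  refine W.mk_eq_zero_of_skewPrimitive (k := W.g i ^ W.r i) ?_ ?_
  · exact Ideal.pow_le_pow_right hr (Ideal.pow_mem_pow (W.tX_mem_ker i) _)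
  · have hG : ∀ n, W.tGrp (W.g i) ^ n = W.tGrp (W.g i ^ n) := by
      intro n
      induction n with
      | zero => simp [tGrp_one]
      | succ n ih => rw [pow_succ, pow_succ, ih, tGrp_mul]
    have hcomm : (W.tGrp (W.g i) ⊗ₜ[K] W.tX i) * (W.tX i ⊗ₜ[K] 1) =
        (W.χ i (W.g i) : K) • ((W.tX i ⊗ₜ[K] 1) * (W.tGrp (W.g i) ⊗ₜ[K] W.tX i)) := by
      simp only [Algebra.TensorProduct.tmul_mul_tmul, tGrp_mul_tX, one_mul, mul_one,
        TensorProduct.smul_tmul']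
    rw [map_pow, tComul_tX]
    refine (add_pow_of_qcomm_of_isPrimitiveRoot
      (B := W.TensorBoson ⊗[K] W.TensorBoson) hcomm hq (by omega)).trans ?_
    rw [Algebra.TensorProduct.tmul_pow, Algebra.TensorProduct.tmul_pow, one_pow, hG]

/-- The braided commutator is skew-primitive: the mixed terms of its coproduct cancel because
`χ_i(g_j) χ_j(g_i) = 1`. -/
theorem x_mul_x {i j : Fin θ} (hij : i ≠ j) :
    W.x i * W.x j = (W.χ j (W.g i) : K) • (W.x j * W.x i) := by
  rw [← sub_eq_zero]
  have hb : (W.χ i (W.g j) : K) * (W.χ j (W.g i) : K) = 1 := by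
    rw [← Units.val_mul, W.braiding i j hij, Units.val_one]
  have hcomm : W.tGrp (W.g j) * W.tGrp (W.g i) = W.tGrp (W.g i) * W.tGrp (W.g j) := by
    rw [← tGrp_mul, ← tGrp_mul, mul_comm]
  refine W.mk_eq_zero_of_skewPrimitive
    (s := W.tX i * W.tX j - (W.χ j (W.g i) : K) • (W.tX j * W.tX i)) (k := W.g i * W.g j) ?_ ?_
  · have h : ∀ i j, W.tX i * W.tX j ∈ RingHom.ker W.tProj ^ 2 := fun i j => by
      rw [Submodule.pow_succ, Submodule.pow_one]
      exact Ideal.mul_mem_mul (W.tX_mem_ker i) (W.tX_mem_ker j)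
    refine sub_mem (h i j) ?_
    rw [Algebra.smul_def]
    exact Ideal.mul_mem_left _ _ (h j i)
  · simp only [map_sub, map_smul, map_mul, tComul_tX, mul_add, add_mul,
      Algebra.TensorProduct.tmul_mul_tmul, tGrp_mul_tX, mul_one, one_mul, smul_add, tGrp_mul,
      ← TensorProduct.smul_tmul', TensorProduct.tmul_smul, TensorProduct.sub_tmul,
      TensorProduct.tmul_sub, smul_smul, hcomm, mul_comm (W.χ j (W.g i) : K), hb, one_smul]
    abel

theorem x_pow_mul_x {i j : Fin θ} (hij : i ≠ j) (n : ℕ) :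
    W.x i ^ n * W.x j = (W.χ j (W.g i) : K) ^ n • (W.x j * W.x i ^ n) := by
  induction n with
  | zero => simp
  | succ n ih =>
    rw [pow_succ', mul_assoc, ih, mul_smul_comm, ← mul_assoc, W.x_mul_x hij, smul_mul_assoc,
      smul_smul, ← pow_succ, mul_assoc]

/-- Reordering a product of powers of `q`-commuting elements. -/
theorem exists_ofFn_prod_mul {B : Type*} [Ring B] [Algebra K B] {t : ℕ} (y : Fin t → B)
    (hy : ∀ i j, i ≠ j → ∀ n : ℕ, ∃ c : K, c ≠ 0 ∧ y i ^ n * y j = c • (y j * y i ^ n))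
    (n : Fin t → ℕ) (j : Fin t) :
    ∃ c : K, c ≠ 0 ∧ (List.ofFn fun i => y i ^ n i).prod * y j =
      c • (List.ofFn fun i => y i ^ (n + Pi.single j 1 : Fin t → ℕ) i).prod := by
  induction t with
  | zero => exact j.elim0
  | succ t ih =>
    simp only [List.ofFn_succ', List.concat_eq_append, List.prod_append, List.prod_singleton]
    induction j using Fin.lastCases with
    | last =>
      refine ⟨1, one_ne_zero, ?_⟩
      have h : ∀ i : Fin t, (Pi.single (Fin.last t) 1 : Fin (t + 1) → ℕ) i.castSucc = 0 :=
        fun i => Pi.single_eq_of_ne (Fin.castSucc_lt_last i).ne _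
      simp only [Pi.add_apply, h, Pi.single_eq_same, pow_succ, mul_assoc, one_smul, add_zero]
    | cast j =>
      obtain ⟨c, hc, h⟩ := hy (Fin.last t) j.castSucc (Fin.castSucc_lt_last j).ne' (n (Fin.last t))
      obtain ⟨d, hd, h'⟩ := ih (fun i => y i.castSucc)
        (fun i k hik => hy _ _ fun e => hik (Fin.castSucc_injective _ e))
        (fun i => n i.castSucc) j
      refine ⟨c * d, mul_ne_zero hc hd, ?_⟩
      have h1 : ∀ i : Fin t, (n + Pi.single j.castSucc 1 : Fin (t + 1) → ℕ) i.castSucc =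
          ((fun i => n i.castSucc) + Pi.single j 1 : Fin t → ℕ) i := fun i => by
        simp [Pi.single_apply]
      have h2 : (n + Pi.single j.castSucc 1 : Fin (t + 1) → ℕ) (Fin.last t) = n (Fin.last t) := by
        simp [(Fin.castSucc_lt_last j).ne']
      simp only [h1, h2]
      rw [mul_assoc, h, mul_smul_comm, ← mul_assoc, h', smul_mul_assoc, smul_smul]

/-- The value of the constant is irrelevant; its nonvanishing allows cancellation in
`convDer_pow_mono`. -/
theorem exists_mono_mul_x (n : Fin θ → ℕ) (j : Fin θ) :
    ∃ c : K, c ≠ 0 ∧ W.mono n * W.x j = c • W.mono (n + Pi.single j 1) :=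
  exists_ofFn_prod_mul W.x (fun _ _ hij n =>
    ⟨_, pow_ne_zero n (Units.ne_zero _), W.x_pow_mul_x hij n⟩) n j

theorem mono_zero : W.mono 0 = 1 := by simp [mono]

theorem mono_eq_zero {n : Fin θ → ℕ} {j : Fin θ} (hj : n j = W.r j) : W.mono n = 0 := by
  refine List.prod_eq_zero ?_
  rw [List.mem_ofFn]
  exact ⟨j, by simp only [hj, x_pow_r]⟩

theorem mono_single (i : Fin θ) (k : ℕ) : W.mono (Pi.single i k) = W.x i ^ k := by
  have h : ∀ (t : ℕ) (y : Fin t → W.A) (i : Fin t),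
      (List.ofFn fun j => y j ^ (Pi.single i k : Fin t → ℕ) j).prod = y i ^ k := by
    intro t
    induction t with
    | zero => exact fun _ i => i.elim0
    | succ t ih =>
      intro y i
      rw [List.ofFn_succ, List.prod_cons]
      induction i using Fin.cases with
      | zero => simp
      | succ i =>
        have h1 : ∀ j : Fin t, (Pi.single i.succ k : Fin (t + 1) → ℕ) j.succ =
            (Pi.single i k : Fin t → ℕ) j := fun j => by simp [Pi.single_apply]
        rw [Pi.single_eq_of_ne (Fin.succ_ne_zero i).symm, pow_zero, one_mul]
        simp only [h1]
        exact ih (fun j => y j.succ) i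
  exact h θ W.x i

/-- The span is stable under right multiplication by generators, an exponent that reaches `r_j`
giving zero. Spanning alone yields uniqueness of `γ_i`; existence comes from a formula, so linear
independence is not needed. -/
theorem span_mono_mul_grp :
    Submodule.span K {y | ∃ n : Fin θ → ℕ, (∀ j, n j < W.r j) ∧ ∃ h, y = W.mono n * W.grp h} =
      ⊤ := by
  refine Submodule.eq_top_iff'.2 (W.induction_right ?_ ?_ ?_)
  · refine Submodule.subset_span ⟨0, fun j => ?_, 1, by rw [mono_zero, grp_one, mul_one]⟩
    have := W.two_le j
    simp only [Pi.zero_apply]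
    omega
  · intro y hy h
    induction hy using Submodule.span_induction with
    | mem y hy =>
      obtain ⟨n, hn, k, rfl⟩ := hy
      exact Submodule.subset_span ⟨n, hn, k * h, by rw [grp_mul, mul_assoc]⟩
    | zero => simp
    | add y z _ _ hy hz => rw [add_mul]; exact add_mem hy hz
    | smul c y _ hy => rw [smul_mul_assoc]; exact Submodule.smul_mem _ _ hy
  · intro y hy j
    induction hy using Submodule.span_induction with
    | mem y hy =>
      obtain ⟨n, hn, k, rfl⟩ := hy
      obtain ⟨c, -, hc⟩ := W.exists_mono_mul_x n j
      rw [mul_assoc, grp_mul_x, mul_smul_comm, ← mul_assoc, hc, smul_mul_assoc, smul_smul]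
      refine Submodule.smul_mem _ _ ?_
      by_cases hj : n j + 1 = W.r j
      · rw [W.mono_eq_zero (j := j) (by simpa using hj), zero_mul]
        exact zero_mem _
      · refine Submodule.subset_span ⟨_, fun l => ?_, k, rfl⟩
        by_cases hl : l = j
        · subst hl
          have := hn l
          simp only [Pi.add_apply, Pi.single_eq_same]
          omega
        · simpa [Pi.single_eq_of_ne hl] using hn l
    | zero => simp
    | add y z _ _ hy hz => rw [add_mul]; exact add_mem hy hz
    | smul c y _ hy => rw [smul_mul_assoc]; exact Submodule.smul_mem _ _ hy

end QuantumLinearSpace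

/-! ### Convolution products and shifts -/

namespace QuantumLinearSpace

open WithConv

section Convolution

variable {K : Type*} [Field K] {X : Type*} [AddCommGroup X] [Module K X]
  {B : Type*} [Ring B] [Algebra K B]

/-- Scalar-valued maps, seen as maps with values in an algebra. -/
def convScal (B : Type*) [Ring B] [Algebra K B] (φ : WithConv (X →ₗ[K] K)) :
    WithConv (X →ₗ[K] B) :=
  toConv (Algebra.linearMap K B ∘ₗ φ.ofConv)

theorem convScal_apply (φ : WithConv (X →ₗ[K] K)) (y : X) :
    convScal B φ y = algebraMap K B (φ y) := rfl

variable [Coalgebra K X]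

theorem convScal_one : convScal B (1 : WithConv (X →ₗ[K] K)) = 1 := rfl

theorem convScal_mul (φ ψ : WithConv (X →ₗ[K] K)) :
    convScal B (φ * ψ) = convScal B φ * convScal B ψ :=
  congrArg toConv (LinearMap.algHom_comp_convMul_distrib (Algebra.ofId K B) φ ψ)

theorem convScal_add (φ ψ : WithConv (X →ₗ[K] K)) :
    convScal B (φ + ψ) = convScal B φ + convScal B ψ := by
  ext; simp [convScal]

theorem convScal_zero : convScal B (0 : WithConv (X →ₗ[K] K)) = 0 := by
  ext; simp [convScal]

theorem convScal_smul (c : K) (φ : WithConv (X →ₗ[K] K)) :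
    convScal B (c • φ) = c • convScal B φ :=
  ofConv_injective (LinearMap.ext fun y => map_smul (Algebra.linearMap K B) c (φ y))

/-- A scalar convolution factor passes through a linear form. This and the next lemma move `λ ∘ π`
inside `α * m_A * α⁻¹`. -/
theorem comp_convScal_mul (f : B →ₗ[K] K) (φ : WithConv (X →ₗ[K] K))
    (Φ : WithConv (X →ₗ[K] B)) :
    toConv (f ∘ₗ (convScal B φ * Φ).ofConv) = φ * toConv (f ∘ₗ Φ.ofConv) := by
  have h : f ∘ₗ LinearMap.mul' K B ∘ₗ TensorProduct.map (convScal B φ).ofConv Φ.ofConv =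
      LinearMap.mul' K K ∘ₗ TensorProduct.map φ.ofConv (f ∘ₗ Φ.ofConv) :=
    TensorProduct.ext' fun a b => by
      simp [convScal_apply, ← Algebra.smul_def]
  exact congrArg toConv (congrArg (· ∘ₗ Coalgebra.comul) h)

theorem comp_mul_convScal (f : B →ₗ[K] K) (φ : WithConv (X →ₗ[K] K))
    (Φ : WithConv (X →ₗ[K] B)) :
    toConv (f ∘ₗ (Φ * convScal B φ).ofConv) = toConv (f ∘ₗ Φ.ofConv) * φ := by
  have h : f ∘ₗ LinearMap.mul' K B ∘ₗ TensorProduct.map Φ.ofConv (convScal B φ).ofConv =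
      LinearMap.mul' K K ∘ₗ TensorProduct.map (f ∘ₗ Φ.ofConv) φ.ofConv :=
    TensorProduct.ext' fun a b => by
      simp [convScal_apply, ← Algebra.commutes, ← Algebra.smul_def, mul_comm]
  exact congrArg toConv (congrArg (· ∘ₗ Coalgebra.comul) h)

end Convolution

/-! ### Products of maps on the two tensor factors -/

section Box

variable {K : Type*} [Field K] {X : Type*} [AddCommGroup X] [Module K X]
  {B : Type*} [CommRing B] [Algebra K B]

/-- The map `y ⊗ z ↦ Φ(y) Ψ(z)`. -/
def box (Φ Ψ : WithConv (X →ₗ[K] B)) : WithConv (X ⊗[K] X →ₗ[K] B) :=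
  toConv (LinearMap.mul' K B ∘ₗ TensorProduct.map Φ.ofConv Ψ.ofConv)

theorem convScal_box (φ ψ : WithConv (X →ₗ[K] K)) :
    convScal B (box φ ψ) = box (convScal B φ) (convScal B ψ) :=
  ofConv_injective (TensorProduct.ext' fun y z => map_mul (algebraMap K B) (φ y) (ψ z))

variable [Coalgebra K X]

/-- Since `B` is commutative, its multiplication `B ⊗ B → B` is an algebra map and respects
convolution. -/
theorem box_mul (Φ Ψ Φ' Ψ' : WithConv (X →ₗ[K] B)) :
    box Φ Ψ * box Φ' Ψ' = box (Φ * Φ') (Ψ * Ψ') := by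
  have h := TensorProduct.map_convMul_map (f := Φ) (g := Ψ) (h := Φ') (k := Ψ')
  have h' := LinearMap.algHom_comp_convMul_distrib (R := K) (Algebra.TensorProduct.lmul' K (S := B))
    (toConv (TensorProduct.map Φ.ofConv Ψ.ofConv)) (toConv (TensorProduct.map Φ'.ofConv Ψ'.ofConv))
  rw [h] at h'
  exact (congrArg toConv h').symm

theorem box_smul_left (c : B) (Φ Ψ : WithConv (X →ₗ[K] B)) : box (c • Φ) Ψ = c • box Φ Ψ :=
  ofConv_injective (TensorProduct.ext' fun y z => smul_mul_assoc c (Φ y) (Ψ z))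

theorem box_smul_right (c : B) (Φ Ψ : WithConv (X →ₗ[K] B)) : box Φ (c • Ψ) = c • box Φ Ψ :=
  ofConv_injective (TensorProduct.ext' fun y z => mul_smul_comm c (Φ y) (Ψ z))

theorem box_zero_left (Ψ : WithConv (X →ₗ[K] B)) : box 0 Ψ = 0 :=
  ofConv_injective (TensorProduct.ext' fun _ z => zero_mul (Ψ z))

theorem box_zero_right (Φ : WithConv (X →ₗ[K] B)) : box Φ 0 = 0 :=
  ofConv_injective (TensorProduct.ext' fun y _ => mul_zero (Φ y))

end Box

/-! ### Degrees in `Γ` of linear forms -/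

section Degree

variable {K : Type*} [Field K] {Γ : Type*} [CommGroup Γ] {X : Type*} [AddCommGroup X] [Module K X]
  [Coalgebra K X]

/-- `φ` has degree `k ∈ Γ` with respect to `P : X → K[Γ]`: `P * φ = k (φ * P)`. -/
def HasDeg (P : WithConv (X →ₗ[K] MonoidAlgebra K Γ)) (φ : WithConv (X →ₗ[K] K)) (k : Γ) : Prop :=
  P * convScal _ φ = MonoidAlgebra.of K Γ k • (convScal _ φ * P)

variable {P : WithConv (X →ₗ[K] MonoidAlgebra K Γ)} {φ ψ : WithConv (X →ₗ[K] K)} {k l : Γ}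

theorem HasDeg.one : HasDeg P 1 1 := by
  rw [HasDeg, convScal_one, map_one, one_smul, one_mul, mul_one]

theorem HasDeg.mul (h : HasDeg P φ k) (h' : HasDeg P ψ l) : HasDeg P (φ * ψ) (k * l) := by
  rw [HasDeg] at h h' ⊢
  rw [convScal_mul, ← mul_assoc, h, smul_mul_assoc, mul_assoc, h', mul_smul_comm, smul_smul,
    map_mul, mul_assoc]

theorem HasDeg.pow (h : HasDeg P φ k) (n : ℕ) : HasDeg P (φ ^ n) (k ^ n) := by
  induction n with
  | zero => simpa using HasDeg.one
  | succ n ih => simpa [pow_succ] using ih.mul h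

theorem HasDeg.add (h : HasDeg P φ k) (h' : HasDeg P ψ k) : HasDeg P (φ + ψ) k := by
  rw [HasDeg] at h h' ⊢
  rw [convScal_add, mul_add, add_mul, h, h', smul_add]

theorem HasDeg.zero : HasDeg P 0 k := by
  rw [HasDeg, convScal_zero, mul_zero, zero_mul, smul_zero]

theorem HasDeg.smul (h : HasDeg P φ k) (c : K) : HasDeg P (c • φ) k := by
  rw [HasDeg] at h ⊢
  rw [convScal_smul, mul_smul_comm, h, smul_mul_assoc, smul_comm]

theorem HasDeg.sum {ι : Type*} {s : Finset ι} {f : ι → WithConv (X →ₗ[K] K)}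
    (h : ∀ i ∈ s, HasDeg P (f i) k) : HasDeg P (∑ i ∈ s, f i) k :=
  Finset.sum_induction f (HasDeg P · k) (fun _ _ => HasDeg.add) HasDeg.zero h

theorem HasDeg.box (h : HasDeg P φ k) (h' : HasDeg P ψ l) :
    HasDeg (box P P) (box φ ψ) (k * l) := by
  rw [HasDeg] at h h' ⊢
  rw [convScal_box, box_mul, h, h', box_smul_left, box_smul_right, smul_smul, box_mul, map_mul]

end Degree

end QuantumLinearSpace

/-! ### The characters and skew derivations of `A` -/

namespace QuantumLinearSpace

open WithConv

variable {K : Type*} [Field K] {Γ : Type*} [CommGroup Γ] {θ : ℕ} (W : QuantumLinearSpace K Γ θ)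

/-- The character `χ_i` of `T(W) # K[Γ]`, extended by `0` on the `x_j`. -/
def tChar (i : Fin θ) : W.TensorBoson →ₐ[K] K :=
  W.tLift (fun h => (W.χ i h : K)) (fun _ => 0) (by simp) (by simp) (by simp)

theorem tChar_tGrp (i : Fin θ) (h : Γ) : W.tChar i (W.tGrp h) = W.χ i h := by
  rw [tChar, tLift_tGrp]

theorem tChar_tX (i j : Fin θ) : W.tChar i (W.tX j) = 0 := by
  rw [tChar, tLift_tX]

/-- The representation of `T(W) # K[Γ]` by upper triangular matrices with diagonal `χ_i, ε`, in
which `x_i` acts by the matrix unit and the other `x_j` act by zero. -/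
def tMatrix (i : Fin θ) : W.TensorBoson →ₐ[K] Matrix (Fin 2) (Fin 2) K :=
  W.tLift (fun h => !![(W.χ i h : K), 0; 0, 1])
    (fun j => if j = i then !![0, 1; 0, 0] else 0)
    (by rw [map_one, Units.val_one, ← Matrix.one_fin_two])
    (fun h k => by simp)
    (fun h j => by
      by_cases hj : j = i
      · subst hj; simp
      · simp [hj])

theorem tMatrix_tGrp (i : Fin θ) (h : Γ) :
    W.tMatrix i (W.tGrp h) = !![(W.χ i h : K), 0; 0, 1] := by
  rw [tMatrix, tLift_tGrp]

theorem tMatrix_tX (i j : Fin θ) :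
    W.tMatrix i (W.tX j) = if j = i then !![0, 1; 0, 0] else 0 := by
  rw [tMatrix, tLift_tX]

theorem tMatrix_entries (i : Fin θ) (y : W.TensorBoson) :
    W.tMatrix i y 0 0 = W.tChar i y ∧ W.tMatrix i y 1 0 = 0 ∧
      W.tMatrix i y 1 1 = W.tCounit y := by
  -- The three entries are treated together: the lower diagonal entry of a product involves the
  -- lower left entry of its first factor.
  let p : Submodule K W.TensorBoson :=
    { carrier := {y | W.tMatrix i y 0 0 = W.tChar i y ∧ W.tMatrix i y 1 0 = 0 ∧
        W.tMatrix i y 1 1 = W.tCounit y}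
      zero_mem' := by simp
      add_mem' := by
        rintro a b ⟨h1, h2, h3⟩ ⟨h1', h2', h3'⟩
        simp [h1, h2, h3, h1', h2', h3']
      smul_mem' := by
        rintro c a ⟨h1, h2, h3⟩
        simp [h1, h2, h3] }
  refine W.tInduction (p := p) ?_ ?_ ?_ y
  · simp [p]
  · rintro y ⟨h1, h2, h3⟩ h
    simp [p, Matrix.mul_apply, Fin.sum_univ_two, tMatrix_tGrp, tChar_tGrp, tCounit_tGrp, h1, h2, h3]
  · rintro y ⟨h1, h2, h3⟩ j
    by_cases hj : j = i <;>
    simp [p, Matrix.mul_apply, Fin.sum_univ_two, tMatrix_tX, tChar_tX, tCounit_tX, h2, hj]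

theorem nicholsIdeal_le : W.nicholsIdeal ≤ RingHom.ker W.tProj ^ 2 :=
  sSup_le fun _ hI => hI.2.2

theorem tMatrix_mul (i : Fin θ) (y z : W.TensorBoson) :
    W.tMatrix i (y * z) 0 1 =
      W.tMatrix i y 0 1 * W.tCounit z + W.tChar i y * W.tMatrix i z 0 1 := by
  rw [map_mul, Matrix.mul_apply, Fin.sum_univ_two, (W.tMatrix_entries i y).1,
    (W.tMatrix_entries i z).2.2, add_comm]

/-- The linear form `y ↦ tMatrix i y 0 1` of `T(W) # K[Γ]`. -/
def tDer (i : Fin θ) : W.TensorBoson →ₗ[K] K :=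
  Matrix.entryLinearMap K K 0 1 ∘ₗ (W.tMatrix i).toLinearMap

theorem tDer_apply (i : Fin θ) (y : W.TensorBoson) : W.tDer i y = W.tMatrix i y 0 1 := rfl

/-- The corner entry is a skew derivation for `ε` and `χ_i`, which both vanish on the kernel of `π`;
so it kills the square of that kernel. -/
theorem tDer_eq_zero (i : Fin θ) {y : W.TensorBoson} (hy : y ∈ W.nicholsIdeal) :
    W.tDer i y = 0 := by
  have h := W.nicholsIdeal_le hy
  rw [Submodule.pow_succ, Submodule.pow_one] at h
  clear hy
  induction h using Submodule.mul_induction_on' with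
  | mem_mul_mem a ha b hb =>
    rw [tDer_apply, tMatrix_mul, W.tHom_eq_zero W.tCounit_tX hb,
      W.tHom_eq_zero (W.tChar_tX i) ha, mul_zero, zero_mul, add_zero]
  | add a _ b _ ha hb => rw [map_add, ha, hb, add_zero]

/-- The character `χ_i` of `A`, extended by `0` on the `x_j`. -/
def char (i : Fin θ) : W.A →ₐ[K] K :=
  Ideal.Quotient.liftₐ W.nicholsIdeal (W.tChar i) fun _ ha =>
    W.tHom_eq_zero (W.tChar_tX i) (W.nicholsIdeal_le_ker_tProj ha)

/-- The `(ε, χ_i)`-skew derivation of `A` that is `1` on `x_i`, and `0` on `Γ` and on the `x_j`,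
`j ≠ i`. -/
def der (i : Fin θ) : W.A →ₗ[K] K :=
  (W.nicholsIdeal.restrictScalars K).liftQ (W.tDer i) fun _ ha => W.tDer_eq_zero i ha

theorem char_grp (i : Fin θ) (h : Γ) : W.char i (W.grp h) = W.χ i h := W.tChar_tGrp i h

theorem char_x (i j : Fin θ) : W.char i (W.x j) = 0 := W.tChar_tX i j

theorem der_grp (i : Fin θ) (h : Γ) : W.der i (W.grp h) = 0 := by
  change W.tMatrix i (W.tGrp h) 0 1 = 0
  simp [tMatrix_tGrp]

theorem der_x_self (i : Fin θ) : W.der i (W.x i) = 1 := by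
  change W.tMatrix i (W.tX i) 0 1 = 1
  simp [tMatrix_tX]

theorem der_x_of_ne {i j : Fin θ} (hj : j ≠ i) : W.der i (W.x j) = 0 := by
  change W.tMatrix i (W.tX j) 0 1 = 0
  simp [tMatrix_tX, hj]

theorem der_mul (i : Fin θ) (y z : W.A) :
    W.der i (y * z) = W.der i y * Coalgebra.counit (R := K) z + W.char i y * W.der i z := by
  obtain ⟨y, rfl⟩ := Ideal.Quotient.mk_surjective y
  obtain ⟨z, rfl⟩ := Ideal.Quotient.mk_surjective z
  exact W.tMatrix_mul i y z

theorem conv_smul_apply {X : Type*} [AddCommGroup X] [Module K X] {B : Type*} [CommRing B]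
    [Algebra K B] (b : B) (Φ : WithConv (X →ₗ[K] B)) (y : X) : (b • Φ) y = b * Φ y := rfl

/-! ### Right translation of convolution maps by the generators -/

section Shift

variable {B : Type*} [Ring B] [Algebra K B]

/-- The map `y ↦ Φ(y a)`. -/
def shift (a : W.A) (Φ : WithConv (W.A →ₗ[K] B)) : WithConv (W.A →ₗ[K] B) :=
  toConv (Φ.ofConv ∘ₗ LinearMap.mulRight K a)

theorem shift_apply (a : W.A) (Φ : WithConv (W.A →ₗ[K] B)) (y : W.A) :
    W.shift a Φ y = Φ (y * a) := rfl

theorem convScal_shift (a : W.A) (φ : WithConv (W.A →ₗ[K] K)) :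
    W.shift a (convScal B φ) = convScal B (W.shift a φ) := rfl

theorem shift_grp_mul (h : Γ) (Φ Ψ : WithConv (W.A →ₗ[K] B)) :
    W.shift (W.grp h) (Φ * Ψ) = W.shift (W.grp h) Φ * W.shift (W.grp h) Ψ := by
  have H : (LinearMap.mul' K B ∘ₗ TensorProduct.map Φ.ofConv Ψ.ofConv) ∘ₗ
      LinearMap.mulRight K (W.grp h ⊗ₜ[K] W.grp h) =
      LinearMap.mul' K B ∘ₗ TensorProduct.map (W.shift (W.grp h) Φ).ofConv
        (W.shift (W.grp h) Ψ).ofConv :=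
    TensorProduct.ext' fun a b => by simp [shift]
  refine ofConv_injective (LinearMap.ext fun y => ?_)
  rw [shift_apply, LinearMap.convMul_apply, LinearMap.convMul_apply, Bialgebra.comul_mul, comul_grp]
  exact LinearMap.congr_fun H (Coalgebra.comul y)

/-- The two terms are those of `Δ(x_j)`: translation by `x_j` is a skew derivation of the
convolution algebra, twisted by translation by `g_j`. -/
theorem shift_x_mul (j : Fin θ) (Φ Ψ : WithConv (W.A →ₗ[K] B)) :
    W.shift (W.x j) (Φ * Ψ) =
      W.shift (W.x j) Φ * Ψ + W.shift (W.grp (W.g j)) Φ * W.shift (W.x j) Ψ := by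
  have H : (LinearMap.mul' K B ∘ₗ TensorProduct.map Φ.ofConv Ψ.ofConv) ∘ₗ
      LinearMap.mulRight K (W.x j ⊗ₜ[K] 1 + W.grp (W.g j) ⊗ₜ[K] W.x j) =
      LinearMap.mul' K B ∘ₗ TensorProduct.map (W.shift (W.x j) Φ).ofConv Ψ.ofConv +
      LinearMap.mul' K B ∘ₗ TensorProduct.map (W.shift (W.grp (W.g j)) Φ).ofConv
        (W.shift (W.x j) Ψ).ofConv :=
    TensorProduct.ext' fun a b => by simp [shift, mul_add]
  refine ofConv_injective (LinearMap.ext fun y => ?_)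
  rw [shift_apply, LinearMap.convMul_apply, Bialgebra.comul_mul, comul_x]
  exact LinearMap.congr_fun H (Coalgebra.comul y)

/-- Induction on words in the generators. Convolution identities thereby reduce to comparing
translates, without computing coproducts of monomials. -/
theorem conv_ext {Φ Ψ : WithConv (W.A →ₗ[K] B)} (h1 : Φ 1 = Ψ 1)
    (hG : ∀ y h, Φ y = Ψ y → W.shift (W.grp h) Φ y = W.shift (W.grp h) Ψ y)
    (hX : ∀ y j, Φ y = Ψ y → W.shift (W.x j) Φ y = W.shift (W.x j) Ψ y) : Φ = Ψ :=
  ofConv_injective (LinearMap.ext fun y =>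
    W.induction_right (p := LinearMap.eqLocus Φ.ofConv Ψ.ofConv) h1
      (fun y hy h => hG y h hy) (fun y hy j => hX y j hy) y)

theorem conv_apply_one (Φ Ψ : WithConv (W.A →ₗ[K] B)) : (Φ * Ψ) 1 = Φ 1 * Ψ 1 := by
  rw [LinearMap.convMul_apply, Bialgebra.comul_one, Algebra.TensorProduct.one_def]
  simp

/-- For `y ∈ R`, only the term `y ⊗ 1` of `Δ(y)` survives `Ψ` on the second factor. -/
theorem mul_apply_of_mem_nichols {Ψ : WithConv (W.A →ₗ[K] B)} (h1 : Ψ 1 = 1)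
    (hX : ∀ j, W.shift (W.x j) Ψ = 0) (Φ : WithConv (W.A →ₗ[K] B)) {y : W.A}
    (hy : y ∈ W.nichols) : (Φ * Ψ) y = Φ y := by
  -- All `Φ` are taken at once, since the induction step replaces `Φ` by its translate by `x_j`.
  let p : Submodule K W.A :=
    { carrier := {y | ∀ Φ : WithConv (W.A →ₗ[K] B), (Φ * Ψ).ofConv y = Φ.ofConv y}
      zero_mem' := fun Φ => by rw [map_zero, map_zero]
      add_mem' := fun {a b} ha hb Φ => by rw [map_add, map_add, ha, hb]
      smul_mem' := fun c a ha Φ => by rw [map_smul, map_smul, ha] }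
  refine adjoin_le_of_mul_right (p := p) (fun Φ => ?_) ?_ hy Φ
  · exact (W.conv_apply_one Φ Ψ).trans (by rw [h1, mul_one])
  · rintro y hy _ ⟨j, rfl⟩ Φ
    rw [← shift_apply, shift_x_mul, hX, mul_zero, add_zero]
    exact hy _

theorem shift_smul {B : Type*} [CommRing B] [Algebra K B] (a : W.A) (b : B)
    (Φ : WithConv (W.A →ₗ[K] B)) : W.shift a (b • Φ) = b • W.shift a Φ := rfl

end Shift

/-- The projection `π`, in the convolution algebra. -/
def convProj : WithConv (W.A →ₗ[K] MonoidAlgebra K Γ) := toConv W.proj.toLinearMap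

/-- The character `χ_i`, in the convolution algebra. -/
def convChar (i : Fin θ) : WithConv (W.A →ₗ[K] K) := toConv (W.char i).toLinearMap

/-- The skew derivation `der i`, in the convolution algebra. -/
def convDer (i : Fin θ) : WithConv (W.A →ₗ[K] K) := toConv (W.der i)

theorem shift_grp_convProj (h : Γ) :
    W.shift (W.grp h) W.convProj = MonoidAlgebra.of K Γ h • W.convProj := by
  refine ofConv_injective (LinearMap.ext fun y => ?_)
  change W.proj (y * W.grp h) = MonoidAlgebra.of K Γ h * W.proj y
  rw [map_mul, proj_grp, mul_comm]

theorem shift_x_convProj (j : Fin θ) : W.shift (W.x j) W.convProj = 0 := by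
  refine ofConv_injective (LinearMap.ext fun y => ?_)
  change W.proj (y * W.x j) = 0
  rw [map_mul, proj_x, mul_zero]

theorem shift_grp_convChar (h : Γ) (i : Fin θ) :
    W.shift (W.grp h) (W.convChar i) = (W.χ i h : K) • W.convChar i := by
  refine ofConv_injective (LinearMap.ext fun y => ?_)
  change W.char i (y * W.grp h) = (W.χ i h : K) * W.char i y
  rw [map_mul, char_grp, mul_comm]

theorem shift_x_convChar (j i : Fin θ) : W.shift (W.x j) (W.convChar i) = 0 := by
  refine ofConv_injective (LinearMap.ext fun y => ?_)
  change W.char i (y * W.x j) = 0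
  rw [map_mul, char_x, mul_zero]

theorem shift_grp_convDer (h : Γ) (i : Fin θ) :
    W.shift (W.grp h) (W.convDer i) = W.convDer i := by
  refine ofConv_injective (LinearMap.ext fun y => ?_)
  change W.der i (y * W.grp h) = W.der i y
  rw [der_mul, der_grp, counit_grp, mul_zero, mul_one, add_zero]

theorem shift_x_convDer_self (i : Fin θ) : W.shift (W.x i) (W.convDer i) = W.convChar i := by
  refine ofConv_injective (LinearMap.ext fun y => ?_)
  change W.der i (y * W.x i) = W.char i y
  rw [der_mul, der_x_self, counit_x, mul_zero, mul_one, zero_add]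

theorem shift_x_convDer_of_ne {i j : Fin θ} (hj : j ≠ i) :
    W.shift (W.x j) (W.convDer i) = 0 := by
  refine ofConv_injective (LinearMap.ext fun y => ?_)
  change W.der i (y * W.x j) = 0
  rw [der_mul, W.der_x_of_ne hj, counit_x, mul_zero, mul_zero, zero_add]

theorem convProj_one : W.convProj 1 = 1 := map_one W.proj

theorem convChar_one (i : Fin θ) : W.convChar i 1 = 1 := map_one (W.char i)

theorem convDer_one (i : Fin θ) : W.convDer i 1 = 0 := by
  rw [← grp_one]; exact W.der_grp i 1

end QuantumLinearSpace

/-! ### Powers of the skew derivations -/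

namespace QuantumLinearSpace

open WithConv

variable {K : Type*} [Field K] {Γ : Type*} [CommGroup Γ] {θ : ℕ} (W : QuantumLinearSpace K Γ θ)

theorem hasDeg_convChar (i : Fin θ) : HasDeg W.convProj (W.convChar i) 1 := by
  rw [HasDeg, map_one, one_smul]
  refine W.conv_ext ?_ ?_ ?_
  · rw [conv_apply_one, conv_apply_one, convScal_apply, convChar_one, convProj_one, map_one]
  · intro y h hy
    rw [shift_grp_mul, shift_grp_mul, convScal_shift, shift_grp_convChar, shift_grp_convProj,
      convScal_smul, smul_mul_assoc, mul_smul_comm, smul_mul_assoc, mul_smul_comm,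
      smul_comm (W.χ i h : K), conv_smul_apply, conv_smul_apply]
    exact congrArg (fun t => MonoidAlgebra.of K Γ h * ((W.χ i h : K) • t)) hy
  · intro y j _
    rw [shift_x_mul, shift_x_mul, convScal_shift, shift_x_convChar, shift_x_convProj,
      convScal_zero]
    simp only [zero_mul, mul_zero, add_zero]

/-- In `Δ(x_i) = x_i ⊗ 1 + g_i ⊗ x_i`, evaluating `d_i` on the right leaves `g_i`, and on the left
leaves `1`. Translating by `x_i` reduces the identity to the degree of `χ_i`. -/
theorem hasDeg_convDer (i : Fin θ) : HasDeg W.convProj (W.convDer i) (W.g i) := by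
  rw [HasDeg, ← smul_mul_assoc]
  refine W.conv_ext ?_ ?_ ?_
  · rw [smul_mul_assoc, conv_apply_one, convScal_apply, convDer_one, map_zero, mul_zero]
    rw [conv_smul_apply, conv_apply_one, convScal_apply, convDer_one, map_zero, zero_mul, mul_zero]
  · intro y h hy
    rw [shift_grp_mul, shift_grp_mul, convScal_shift, shift_smul, convScal_shift,
      shift_grp_convDer, shift_grp_convProj, smul_mul_assoc, mul_smul_comm, conv_smul_apply,
      conv_smul_apply, hy]
  · intro y j _
    rw [shift_x_mul, shift_x_mul, shift_x_convProj, convScal_shift, shift_smul, convScal_shift,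
      shift_grp_convProj, zero_mul, zero_add, mul_zero, add_zero]
    by_cases hj : j = i
    · subst hj
      have h3 := W.hasDeg_convChar j
      rw [HasDeg, map_one, one_smul] at h3
      rw [shift_x_convDer_self, smul_mul_assoc, smul_mul_assoc, h3]
    · rw [W.shift_x_convDer_of_ne hj, convScal_zero, mul_zero, smul_zero, zero_mul]

theorem convChar_mul_convDer (i : Fin θ) :
    W.convChar i * W.convDer i = (W.χ i (W.g i) : K) • (W.convDer i * W.convChar i) := by
  refine W.conv_ext ?_ ?_ ?_
  · change _ = (W.χ i (W.g i) : K) • (W.convDer i * W.convChar i) 1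
    rw [conv_apply_one, conv_apply_one, convDer_one, mul_zero, zero_mul, smul_zero]
  · intro y h hy
    rw [shift_smul, shift_grp_mul, shift_grp_mul, shift_grp_convChar, shift_grp_convDer,
      smul_mul_assoc, mul_smul_comm, smul_comm]
    exact congrArg ((W.χ i h : K) • ·) hy
  · intro y j _
    rw [shift_smul, shift_x_mul, shift_x_mul, shift_x_convChar, zero_mul, zero_add, mul_zero,
      add_zero, shift_grp_convChar]
    by_cases hj : j = i
    · subst hj
      rw [shift_x_convDer_self, smul_mul_assoc]
    · rw [W.shift_x_convDer_of_ne hj, mul_zero, zero_mul, smul_zero]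

theorem shift_grp_one (h : Γ) :
    W.shift (W.grp h) (1 : WithConv (W.A →ₗ[K] K)) = 1 := by
  refine ofConv_injective (LinearMap.ext fun y => ?_)
  change Coalgebra.counit (R := K) (y * W.grp h) = Coalgebra.counit (R := K) y
  rw [Bialgebra.counit_mul, counit_grp, mul_one]

theorem shift_x_one (j : Fin θ) :
    W.shift (W.x j) (1 : WithConv (W.A →ₗ[K] K)) = 0 := by
  refine ofConv_injective (LinearMap.ext fun y => ?_)
  change Coalgebra.counit (R := K) (y * W.x j) = 0
  rw [Bialgebra.counit_mul, counit_x, mul_zero]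

theorem shift_grp_pow (h : Γ) (φ : WithConv (W.A →ₗ[K] K)) (n : ℕ) :
    W.shift (W.grp h) (φ ^ n) = W.shift (W.grp h) φ ^ n := by
  induction n with
  | zero => rw [pow_zero, pow_zero, shift_grp_one]
  | succ n ih => rw [pow_succ, pow_succ, shift_grp_mul, ih]

/-- A quantum Leibniz rule: moving `χ_i` to the right past each `d_i` costs `χ_i(g_i)`, and the
powers add up to a quantum integer. -/
theorem shift_x_convDer_pow_succ (i : Fin θ) (n : ℕ) :
    W.shift (W.x i) (W.convDer i ^ (n + 1)) =
      qInt (W.χ i (W.g i) : K) (n + 1) • (W.convDer i ^ n * W.convChar i) := by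
  induction n with
  | zero => simp [shift_x_convDer_self, qInt]
  | succ n ih =>
    rw [pow_succ, shift_x_mul, ih, shift_grp_pow, shift_grp_convDer, shift_x_convDer_self,
      smul_mul_assoc, mul_assoc, convChar_mul_convDer, mul_smul_comm, ← mul_assoc, ← pow_succ,
      smul_smul, qInt_succ _ (n + 1), add_smul, one_smul, mul_comm]

theorem shift_x_convDer_pow_of_ne {i j : Fin θ} (hj : j ≠ i) (n : ℕ) :
    W.shift (W.x j) (W.convDer i ^ n) = 0 := by
  induction n with
  | zero => rw [pow_zero, shift_x_one]
  | succ n ih =>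
    rw [pow_succ, shift_x_mul, ih, W.shift_x_convDer_of_ne hj, zero_mul, mul_zero, add_zero]

theorem pow_apply_one (φ : WithConv (W.A →ₗ[K] K)) (n : ℕ) : (φ ^ n) 1 = φ 1 ^ n := by
  induction n with
  | zero =>
    rw [pow_zero, pow_zero]
    exact Bialgebra.counit_one
  | succ n ih => rw [pow_succ, pow_succ, conv_apply_one, ih]

theorem primitive_coe (i : Fin θ) : IsPrimitiveRoot (W.χ i (W.g i) : K) (W.r i) :=
  IsPrimitiveRoot.coe_units_iff.2 (W.primitive i)

theorem convDer_pow_r (i : Fin θ) : W.convDer i ^ W.r i = 0 := by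
  have hr := W.two_le i
  obtain ⟨n, hn⟩ : ∃ n, W.r i = n + 1 := ⟨W.r i - 1, by omega⟩
  refine W.conv_ext ?_ ?_ ?_
  · rw [pow_apply_one, convDer_one, zero_pow (by omega)]; rfl
  · intro y h hy
    rw [shift_grp_pow, shift_grp_convDer]
    exact hy
  · intro y j _
    by_cases hj : j = i
    · subst hj
      have h0 := qInt_eq_zero (W.primitive_coe j) hr
      rw [hn] at h0 ⊢
      rw [shift_x_convDer_pow_succ, h0, zero_smul]
      rfl
    · rw [W.shift_x_convDer_pow_of_ne hj]
      rfl

theorem mul_convChar_apply (φ : WithConv (W.A →ₗ[K] K)) (i : Fin θ) {y : W.A}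
    (hy : y ∈ W.nichols) : (φ * W.convChar i) y = φ y :=
  W.mul_apply_of_mem_nichols (W.convChar_one i) (fun j => W.shift_x_convChar j i) φ hy

theorem mul_convChar_pow_apply (φ : WithConv (W.A →ₗ[K] K)) (i : Fin θ) (l : ℕ) {y : W.A}
    (hy : y ∈ W.nichols) : (φ * W.convChar i ^ l) y = φ y := by
  induction l with
  | zero => rw [pow_zero, mul_one]
  | succ l ih => rw [pow_succ, ← mul_assoc, W.mul_convChar_apply _ _ hy, ih]

theorem x_mem_nichols (i : Fin θ) : W.x i ∈ W.nichols :=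
  Algebra.subset_adjoin ⟨i, rfl⟩

theorem mono_mem_nichols (n : Fin θ → ℕ) : W.mono n ∈ W.nichols := by
  refine Subalgebra.list_prod_mem _ fun y hy => ?_
  obtain ⟨i, rfl⟩ := (List.mem_ofFn' _ _).1 hy
  exact pow_mem (W.x_mem_nichols i) _

theorem convDer_pow_x_pow (i : Fin θ) (k m : ℕ) :
    (W.convDer i ^ k) (W.x i ^ m) = if m = k then qFactorial (W.χ i (W.g i) : K) k else 0 := by
  induction k generalizing m with
  | zero =>
    rw [pow_zero]
    change Coalgebra.counit (R := K) (W.x i ^ m) = _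
    rw [Bialgebra.counit_pow, counit_x, qFactorial_zero, zero_pow_eq]
  | succ k ih =>
    cases m with
    | zero => rw [pow_zero, pow_apply_one, convDer_one]; simp
    | succ m =>
      rw [pow_succ (W.x i), ← shift_apply, shift_x_convDer_pow_succ]
      change _ * (W.convDer i ^ k * W.convChar i) (W.x i ^ m) = _
      rw [W.mul_convChar_apply _ _ (pow_mem (W.x_mem_nichols i) m), ih, qFactorial_succ]
      by_cases h : m = k <;> simp [h, mul_comm]

theorem convDer_pow_mono (i : Fin θ) (k : ℕ) (n : Fin θ → ℕ) :
    (W.convDer i ^ k) (W.mono n) =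
      if n = Pi.single i k then qFactorial (W.χ i (W.g i) : K) k else 0 := by
  -- If another variable `x_j` occurs, it can be moved to the right end, where translation by `x_j`
  -- kills the power of `d_i`.
  by_cases h : ∃ j, j ≠ i ∧ n j ≠ 0
  · obtain ⟨j, hj, hn⟩ := h
    have hn' : n = (n - Pi.single j 1) + Pi.single j 1 := by
      funext l
      by_cases hl : l = j
      · subst hl
        simp; omega
      · simp [hl]
    obtain ⟨c, hc, h⟩ := W.exists_mono_mul_x (n - Pi.single j 1) j
    rw [← hn'] at h
    have h1 : (W.convDer i ^ k) (W.mono (n - Pi.single j 1) * W.x j) = 0 := by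
      rw [← shift_apply, W.shift_x_convDer_pow_of_ne hj]
      rfl
    rw [h, map_smul, smul_eq_mul] at h1
    rw [(mul_eq_zero.1 h1).resolve_left hc, if_neg]
    rintro rfl
    exact hn (Pi.single_eq_of_ne hj _)
  · push Not at h
    obtain ⟨m, rfl⟩ : ∃ m, n = Pi.single i m := by
      refine ⟨n i, funext fun j => ?_⟩
      by_cases hj : j = i
      · subst hj; simp
      · simp [hj, h j hj]
    rw [mono_single, convDer_pow_x_pow]
    simp only [Pi.single_inj]

end QuantumLinearSpace

/-! ### The maps `γ_i` -/

namespace QuantumLinearSpace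

open WithConv

variable {K : Type*} [Field K] {Γ : Type*} [CommGroup Γ] {θ : ℕ} (W : QuantumLinearSpace K Γ θ)

theorem mul_apply_grp_mul {h : Γ} {c d : K} {φ ψ : WithConv (W.A →ₗ[K] K)}
    (hφ : ∀ y, φ (W.grp h * y) = c * φ y) (hψ : ∀ y, ψ (W.grp h * y) = d * ψ y) (y : W.A) :
    (φ * ψ) (W.grp h * y) = c * d * (φ * ψ) y := by
  have H : (LinearMap.mul' K K ∘ₗ TensorProduct.map φ.ofConv ψ.ofConv) ∘ₗ
      LinearMap.mulLeft K (W.grp h ⊗ₜ[K] W.grp h) =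
      (c * d) • (LinearMap.mul' K K ∘ₗ TensorProduct.map φ.ofConv ψ.ofConv) :=
    TensorProduct.ext' fun a b => by simp [hφ, hψ]; ring
  rw [LinearMap.convMul_apply, LinearMap.convMul_apply, Bialgebra.comul_mul, comul_grp]
  exact LinearMap.congr_fun H (Coalgebra.comul y)

theorem pow_apply_grp_mul {h : Γ} {c : K} {φ : WithConv (W.A →ₗ[K] K)}
    (hφ : ∀ y, φ (W.grp h * y) = c * φ y) (n : ℕ) (y : W.A) :
    (φ ^ n) (W.grp h * y) = c ^ n * (φ ^ n) y := by
  induction n generalizing y with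
  | zero =>
    rw [pow_zero, pow_zero, one_mul]
    change Coalgebra.counit (R := K) (W.grp h * y) = Coalgebra.counit (R := K) y
    rw [Bialgebra.counit_mul, counit_grp, one_mul]
  | succ n ih =>
    rw [pow_succ, pow_succ]
    exact W.mul_apply_grp_mul ih hφ y

theorem convChar_grp_mul (i : Fin θ) (h : Γ) (y : W.A) :
    W.convChar i (W.grp h * y) = W.χ i h * W.convChar i y := by
  change W.char i (W.grp h * y) = W.χ i h * W.char i y
  rw [map_mul, char_grp]

theorem convDer_grp_mul (i : Fin θ) (h : Γ) (y : W.A) :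
    W.convDer i (W.grp h * y) = W.χ i h * W.convDer i y := by
  change W.der i (W.grp h * y) = W.χ i h * W.der i y
  rw [der_mul, der_grp, char_grp, zero_mul, zero_add]

/-- The first factor of the `k`-th term of `eta i`. -/
def etaLeft (i : Fin θ) (k : ℕ) : WithConv (W.A →ₗ[K] K) :=
  W.convDer i ^ k * W.convChar i ^ (W.r i - k)

/-- The factor `χ_i ^ (r_i - k)` is invisible on `R`. It completes the weight `χ_i ^ k` of `d_i ^ k`
to `χ_i ^ r_i = ε`, and it makes `η_i` balanced against `d_i ^ (r_i - k)`. -/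
theorem etaLeft_grp_mul {i : Fin θ} (hχ : W.χ i ^ W.r i = 1) {k : ℕ} (hk : k ≤ W.r i) (h : Γ)
    (y : W.A) : W.etaLeft i k (W.grp h * y) = W.etaLeft i k y := by
  have h1 : (W.χ i h : K) ^ k * (W.χ i h : K) ^ (W.r i - k) = 1 := by
    rw [← pow_add, Nat.add_sub_of_le hk, ← Units.val_pow_eq_pow_val, ← MonoidHom.pow_apply, hχ]
    simp
  refine (W.mul_apply_grp_mul (W.pow_apply_grp_mul (W.convDer_grp_mul i h) k)
    (W.pow_apply_grp_mul (W.convChar_grp_mul i h) (W.r i - k)) y).trans ?_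
  rw [h1, one_mul, etaLeft]

theorem etaLeft_mul_grp (i : Fin θ) (k : ℕ) (h : Γ) (y : W.A) :
    W.etaLeft i k (y * W.grp h) = (W.χ i h : K) ^ (W.r i - k) * W.etaLeft i k y := by
  rw [← shift_apply, etaLeft, shift_grp_mul, shift_grp_pow, shift_grp_pow, shift_grp_convDer,
    shift_grp_convChar, smul_pow, mul_smul_comm, conv_smul_apply]

theorem convDer_pow_mul_grp (i : Fin θ) (k : ℕ) (h : Γ) (y : W.A) :
    (W.convDer i ^ k) (y * W.grp h) = (W.convDer i ^ k) y := by
  rw [← shift_apply, shift_grp_pow, shift_grp_convDer]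

/-- The map with `x_i ^ k ⊗ x_i ^ (r_i - k) ↦ 1` for `0 < k < r_i`, zero on the other pairs of
monomials, that is `H`-balanced and right `H`-linear. -/
def eta (i : Fin θ) : WithConv (W.A ⊗[K] W.A →ₗ[K] K) :=
  ∑ k ∈ Finset.Ioo 0 (W.r i),
    (qFactorial (W.χ i (W.g i) : K) k * qFactorial (W.χ i (W.g i) : K) (W.r i - k))⁻¹ •
      box (W.etaLeft i k) (W.convDer i ^ (W.r i - k))

theorem eta_apply (i : Fin θ) (y z : W.A) :
    W.eta i (y ⊗ₜ z) = ∑ k ∈ Finset.Ioo 0 (W.r i),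
      (qFactorial (W.χ i (W.g i) : K) k * qFactorial (W.χ i (W.g i) : K) (W.r i - k))⁻¹ *
        (W.etaLeft i k y * (W.convDer i ^ (W.r i - k)) z) := by
  let ev : WithConv (W.A ⊗[K] W.A →ₗ[K] K) →+ K :=
    { toFun := fun φ => φ (y ⊗ₜ z)
      map_zero' := rfl
      map_add' := fun _ _ => rfl }
  exact map_sum ev _ _

theorem eta_mono (i : Fin θ) (n m : Fin θ → ℕ) :
    W.eta i (W.mono n ⊗ₜ W.mono m) = ∑ k ∈ Finset.Ioo 0 (W.r i),
      if n = Pi.single i k ∧ m = Pi.single i (W.r i - k) then 1 else 0 := by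
  rw [eta_apply]
  refine Finset.sum_congr rfl fun k hk => ?_
  rw [Finset.mem_Ioo] at hk
  have h1 := qFactorial_ne_zero (W.primitive_coe i) hk.2
  have h2 := qFactorial_ne_zero (W.primitive_coe i) (n := W.r i - k) (by omega)
  rw [etaLeft, W.mul_convChar_pow_apply _ _ _ (W.mono_mem_nichols n), convDer_pow_mono,
    convDer_pow_mono]
  by_cases hn : n = Pi.single i k <;> by_cases hm : m = Pi.single i (W.r i - k) <;>
    simp only [hn, hm, if_true, if_false, and_self, and_false, false_and, mul_zero, zero_mul]
  exact inv_mul_cancel₀ (mul_ne_zero h1 h2)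

theorem convChar_mul_convDer_pow (i : Fin θ) (l m : ℕ) :
    ∃ c : K, W.convChar i ^ l * W.convDer i ^ m = c • (W.convDer i ^ m * W.convChar i ^ l) := by
  induction l with
  | zero => exact ⟨1, by simp⟩
  | succ l ih =>
    obtain ⟨c, hc⟩ := ih
    refine ⟨(W.χ i (W.g i) : K) ^ m * c, ?_⟩
    rw [pow_succ, mul_assoc, mul_pow_of_qcomm (W.convChar_mul_convDer i), mul_smul_comm,
      ← mul_assoc, hc, smul_mul_assoc, smul_smul, mul_assoc]

theorem convDer_pow_eq_zero (i : Fin θ) {n : ℕ} (hn : W.r i ≤ n) : W.convDer i ^ n = 0 := by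
  rw [← Nat.add_sub_of_le hn, pow_add, convDer_pow_r, zero_mul]

/-- The term indexed by `k, l` carries `d_i ^ (k + l)` on the left and `d_i ^ (2 r_i - k - l)` on
the right, up to powers of `χ_i`; one of these exponents is at least `r_i`. -/
theorem eta_mul_eta (i : Fin θ) : W.eta i * W.eta i = 0 := by
  rw [eta, Finset.sum_mul_sum]
  refine Finset.sum_eq_zero fun k hk => Finset.sum_eq_zero fun l hl => ?_
  rw [Finset.mem_Ioo] at hk hl
  rw [smul_mul_assoc, mul_smul_comm, box_mul, ← pow_add]
  by_cases h : W.r i ≤ k + l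
  · obtain ⟨c, hc⟩ := W.convChar_mul_convDer_pow i (W.r i - k) l
    have h0 : W.etaLeft i k * W.etaLeft i l = 0 := by
      rw [etaLeft, etaLeft, mul_assoc, ← mul_assoc (W.convChar i ^ (W.r i - k)), hc,
        smul_mul_assoc, mul_smul_comm, mul_assoc, ← mul_assoc, ← pow_add,
        W.convDer_pow_eq_zero i h, zero_mul, smul_zero]
    rw [h0, box_zero_left, smul_zero, smul_zero]
  · rw [W.convDer_pow_eq_zero i (by omega : W.r i ≤ W.r i - k + (W.r i - l)), box_zero_right,
      smul_zero, smul_zero]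

theorem hasDeg_eta (i : Fin θ) :
    HasDeg (box W.convProj W.convProj) (W.eta i) (W.g i ^ W.r i) := by
  refine HasDeg.sum fun k hk => HasDeg.smul ?_ _
  rw [Finset.mem_Ioo] at hk
  have h1 := ((W.hasDeg_convDer i).pow k).mul ((W.hasDeg_convChar i).pow (W.r i - k))
  have h2 := h1.box ((W.hasDeg_convDer i).pow (W.r i - k))
  rwa [one_pow, mul_one, ← pow_add, Nat.add_sub_of_le hk.2.le] at h2

theorem isGamma_of_grp {i : Fin θ} {a : K} {γ : W.A ⊗[K] W.A →ₗ[K] K}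
    (left : ∀ h y z, γ ((W.grp h * y) ⊗ₜ z) = γ (y ⊗ₜ z))
    (right : ∀ h y z, γ (y ⊗ₜ (z * W.grp h)) = γ (y ⊗ₜ z))
    (balanced : ∀ h y z, γ ((y * W.grp h) ⊗ₜ z) = γ (y ⊗ₜ (W.grp h * z)))
    (exceptional : ∀ k, 0 < k → k < W.r i → γ ((W.x i ^ k) ⊗ₜ (W.x i ^ (W.r i - k))) = a)
    (trivial : ∀ n m : Fin θ → ℕ, (∀ j, n j < W.r j) → (∀ j, m j < W.r j) →
      (¬ ∃ k, 0 < k ∧ k < W.r i ∧ n = Pi.single i k ∧ m = Pi.single i (W.r i - k)) →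
      γ (W.mono n ⊗ₜ W.mono m) =
        Coalgebra.counit (R := K) (W.mono n) * Coalgebra.counit (R := K) (W.mono m)) :
    W.IsGamma i a γ where
  left h y z := by
    induction h using MonoidAlgebra.induction_linear with
    | zero => simp
    | add p q hp hq => simp only [map_add, add_mul, TensorProduct.add_tmul, hp, hq]
    | single h c =>
      rw [incl_single, smul_mul_assoc, ← TensorProduct.smul_tmul', map_smul, left]
      simp
  right h y z := by
    induction h using MonoidAlgebra.induction_linear with
    | zero => simp
    | add p q hp hq => simp only [map_add, mul_add, TensorProduct.tmul_add, hp, hq]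
    | single h c =>
      rw [incl_single, mul_smul_comm, TensorProduct.tmul_smul, map_smul, right]
      simp [mul_comm]
  balanced h y z := by
    induction h using MonoidAlgebra.induction_linear with
    | zero => simp
    | add p q hp hq =>
      simp only [map_add, mul_add, add_mul, TensorProduct.tmul_add, TensorProduct.add_tmul, hp, hq]
    | single h c =>
      rw [incl_single, mul_smul_comm, smul_mul_assoc, TensorProduct.tmul_smul,
        ← TensorProduct.smul_tmul', map_smul, map_smul, balanced]
  exceptional := exceptional
  trivial := trivial

theorem one_add_smul_eta_apply (i : Fin θ) (a : K) (y z : W.A) :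
    (1 + a • W.eta i) (y ⊗ₜ z) =
      Coalgebra.counit (R := K) z * Coalgebra.counit (R := K) y + a * W.eta i (y ⊗ₜ z) := rfl

theorem counit_x_pow (i : Fin θ) {k : ℕ} (hk : 0 < k) :
    Coalgebra.counit (R := K) (W.x i ^ k) = 0 := by
  rw [Bialgebra.counit_pow, counit_x, zero_pow hk.ne']

theorem isGamma_one_add_smul_eta {i : Fin θ} (hχ : W.χ i ^ W.r i = 1) (a : K) :
    W.IsGamma i a (1 + a • W.eta i).ofConv := by
  refine W.isGamma_of_grp ?_ ?_ ?_ ?_ ?_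
  · intro h y z
    rw [one_add_smul_eta_apply, one_add_smul_eta_apply, Bialgebra.counit_mul, counit_grp, one_mul,
      eta_apply, eta_apply]
    congr 2
    refine Finset.sum_congr rfl fun k hk => ?_
    rw [W.etaLeft_grp_mul hχ (Finset.mem_Ioo.1 hk).2.le]
  · intro h y z
    rw [one_add_smul_eta_apply, one_add_smul_eta_apply, Bialgebra.counit_mul, counit_grp, mul_one,
      eta_apply, eta_apply]
    congr 2
    refine Finset.sum_congr rfl fun k hk => ?_
    rw [convDer_pow_mul_grp]
  · intro h y z
    rw [one_add_smul_eta_apply, one_add_smul_eta_apply, Bialgebra.counit_mul,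
      Bialgebra.counit_mul, counit_grp, mul_one, one_mul, eta_apply, eta_apply]
    congr 2
    refine Finset.sum_congr rfl fun k hk => ?_
    rw [etaLeft_mul_grp, W.pow_apply_grp_mul (W.convDer_grp_mul i h), mul_left_comm, mul_assoc]
    ring
  · intro k h0 hk
    rw [one_add_smul_eta_apply, W.counit_x_pow i h0, mul_zero, zero_add, ← mono_single,
      ← mono_single, eta_mono, Finset.sum_eq_single k]
    · simp
    · intro l _ hl
      rw [if_neg]
      exact fun h => hl (Pi.single_injective i h.1).symm
    · exact fun h => absurd (Finset.mem_Ioo.2 ⟨h0, hk⟩) h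
  · intro n m _ _ hnm
    rw [one_add_smul_eta_apply, eta_mono, Finset.sum_eq_zero, mul_zero, add_zero, mul_comm]
    intro k hk
    rw [Finset.mem_Ioo] at hk
    exact if_neg fun h => hnm ⟨k, hk.1, hk.2, h⟩

theorem exists_grp_mul_mono (h : Γ) (n : Fin θ → ℕ) :
    ∃ c : K, W.grp h * W.mono n = c • (W.mono n * W.grp h) := by
  have H : ∀ l : List W.A, (∀ y ∈ l, ∃ c : K, W.grp h * y = c • (y * W.grp h)) →
      ∃ c : K, W.grp h * l.prod = c • (l.prod * W.grp h) := by
    intro l hl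
    induction l with
    | nil => exact ⟨1, by simp⟩
    | cons y l ih =>
      obtain ⟨c, hc⟩ := hl y (by simp)
      obtain ⟨d, hd⟩ := ih fun z hz => hl z (by simp [hz])
      refine ⟨c * d, ?_⟩
      rw [List.prod_cons, ← mul_assoc, hc, smul_mul_assoc, mul_assoc, hd, mul_smul_comm, smul_smul,
        mul_assoc]
  refine H _ fun y hy => ?_
  obtain ⟨i, rfl⟩ := (List.mem_ofFn' _ _).1 hy
  exact ⟨_, mul_pow_of_qcomm (W.grp_mul_x h i) (n i)⟩

-- Group elements can be stripped from spanning pairs: the one in the middle moves across the tensor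
-- sign, past the second monomial up to a scalar, and out on the right.
variable {W} in
theorem IsGamma.unique {i : Fin θ} {a : K} {γ γ' : W.A ⊗[K] W.A →ₗ[K] K} (hγ : W.IsGamma i a γ)
    (hγ' : W.IsGamma i a γ') : γ = γ' := by
  have hmono : ∀ n m : Fin θ → ℕ, (∀ j, n j < W.r j) → (∀ j, m j < W.r j) →
      γ (W.mono n ⊗ₜ W.mono m) = γ' (W.mono n ⊗ₜ W.mono m) := by
    intro n m hn hm
    by_cases h : ∃ k, 0 < k ∧ k < W.r i ∧ n = Pi.single i k ∧ m = Pi.single i (W.r i - k)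
    · obtain ⟨k, h0, hk, rfl, rfl⟩ := h
      rw [mono_single, mono_single, hγ.exceptional k h0 hk, hγ'.exceptional k h0 hk]
    · rw [hγ.trivial n m hn hm h, hγ'.trivial n m hn hm h]
  refine TensorProduct.ext (LinearMap.ext_on W.span_mono_mul_grp ?_)
  rintro _ ⟨n, hn, h, rfl⟩
  refine LinearMap.ext_on W.span_mono_mul_grp ?_
  rintro _ ⟨m, hm, k, rfl⟩
  obtain ⟨c, hc⟩ := W.exists_grp_mul_mono h m
  change γ ((W.mono n * W.grp h) ⊗ₜ (W.mono m * W.grp k)) =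
    γ' ((W.mono n * W.grp h) ⊗ₜ (W.mono m * W.grp k))
  rw [← incl_of, ← incl_of, hγ.right, hγ'.right, hγ.balanced, hγ'.balanced, incl_of, hc,
    TensorProduct.tmul_smul, map_smul, map_smul, ← incl_of, hγ.right, hγ'.right, hmono n m hn hm]

theorem gamma_eq {i : Fin θ} (hχ : W.χ i ^ W.r i = 1) (a : K) :
    W.gamma i a = 1 + a • W.eta i := by
  have h : ∃ γ, W.IsGamma i a γ := ⟨_, W.isGamma_one_add_smul_eta hχ a⟩
  rw [gamma, dif_pos h]
  exact ofConv_injective (h.choose_spec.unique (W.isGamma_one_add_smul_eta hχ a))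

end QuantumLinearSpace

/-! ### The twist -/

namespace QuantumLinearSpace

open WithConv

variable {K : Type*} [Field K] {Γ : Type*} [CommGroup Γ] {θ : ℕ} (W : QuantumLinearSpace K Γ θ)

theorem integral_of_mul_algebraMap (k : Γ) (c : K) :
    integral K Γ (MonoidAlgebra.of K Γ k * algebraMap K _ c) =
      integral K Γ (MonoidAlgebra.of K Γ k) * c := by
  rw [← Algebra.commutes, ← Algebra.smul_def, map_smul, smul_eq_mul, mul_comm]

theorem integral_of_one : integral K Γ (MonoidAlgebra.of K Γ 1) = 1 := by
  simp [integral]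

theorem integral_of_of_ne_one {k : Γ} (hk : k ≠ 1) :
    integral K Γ (MonoidAlgebra.of K Γ k) = 0 := by
  simp [integral, hk]

/-- Coinvariance of `R`: both sides are algebra maps in `y`, so it suffices to check the generators
`x_i`. -/
theorem map_proj_comul {y : W.A} (hy : y ∈ W.nichols) :
    TensorProduct.map LinearMap.id W.proj.toLinearMap (Coalgebra.comul (R := K) y) =
      y ⊗ₜ[K] (1 : MonoidAlgebra K Γ) := by
  have h : Set.EqOn ((Algebra.TensorProduct.map (AlgHom.id K W.A) W.proj).comp
      (Bialgebra.comulAlgHom K W.A))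
      (Algebra.TensorProduct.includeLeft : W.A →ₐ[K] W.A ⊗[K] MonoidAlgebra K Γ)
      (Set.range W.x) := by
    rintro _ ⟨i, rfl⟩
    simp [comul_x, proj_x]
  exact AlgHom.eqOn_adjoin_iff.2 h hy

theorem convScal_mul_box_convProj_apply (ψ : WithConv (W.A ⊗[K] W.A →ₗ[K] K)) {y z : W.A}
    (hy : y ∈ W.nichols) (hz : z ∈ W.nichols) :
    (convScal (MonoidAlgebra K Γ) ψ * box W.convProj W.convProj) (y ⊗ₜ z) =
      algebraMap K _ (ψ (y ⊗ₜ z)) := by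
  let F : (W.A ⊗[K] MonoidAlgebra K Γ) ⊗[K] (W.A ⊗[K] MonoidAlgebra K Γ) →ₗ[K] MonoidAlgebra K Γ :=
    LinearMap.mul' K (MonoidAlgebra K Γ) ∘ₗ
      TensorProduct.map (convScal (MonoidAlgebra K Γ) ψ).ofConv (LinearMap.mul' K _) ∘ₗ
      (TensorProduct.tensorTensorTensorComm K W.A (MonoidAlgebra K Γ) W.A
        (MonoidAlgebra K Γ)).toLinearMap
  let ρ : W.A ⊗[K] W.A →ₗ[K] W.A ⊗[K] MonoidAlgebra K Γ :=
    TensorProduct.map LinearMap.id W.proj.toLinearMap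
  -- The comultiplication of `A ⊗ A` is `Δ ⊗ Δ` followed by a middle swap. Regrouping applies `id ⊗
  -- π` to `Δ(y)` and `Δ(z)` separately, where coinvariance is available.
  have h : (LinearMap.mul' K (MonoidAlgebra K Γ) ∘ₗ
      TensorProduct.map (convScal (MonoidAlgebra K Γ) ψ).ofConv
        (box W.convProj W.convProj).ofConv) ∘ₗ
      (TensorProduct.tensorTensorTensorComm K W.A W.A W.A W.A).toLinearMap =
      F ∘ₗ TensorProduct.map ρ ρ := by
    apply TensorProduct.ext_fourfold'
    intro a b c d
    rfl
  have h' := LinearMap.congr_fun h (Coalgebra.comul y ⊗ₜ Coalgebra.comul z)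
  refine h'.trans ?_
  rw [LinearMap.comp_apply, TensorProduct.map_tmul, W.map_proj_comul hy, W.map_proj_comul hz]
  simp [F, convScal_apply]

/-- The linear form `λ ∘ π ∘ m` on `A ⊗ A`, in the convolution algebra. -/
def convIntegral : WithConv (W.A ⊗[K] W.A →ₗ[K] K) :=
  toConv (integral K Γ ∘ₗ (box W.convProj W.convProj).ofConv)

theorem integral_comp_twistedMul (α : WithConv (W.A ⊗[K] W.A →ₗ[K] K)) :
    integral K Γ ∘ₗ W.proj.toLinearMap ∘ₗ W.twistedMul α =
      (α * W.convIntegral * Ring.inverse α).ofConv := by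
  have h0 : toConv ((integral K Γ ∘ₗ W.proj.toLinearMap) ∘ₗ LinearMap.mul' K W.A) =
      W.convIntegral :=
    ofConv_injective (TensorProduct.ext' fun y z =>
      congrArg (integral K Γ) (map_mul W.proj y z))
  rw [← h0, ← LinearMap.comp_assoc]
  have h1 := comp_mul_convScal (integral K Γ ∘ₗ W.proj.toLinearMap) (Ring.inverse α)
    (convScal W.A α * toConv (LinearMap.mul' K W.A))
  rw [comp_convScal_mul] at h1
  exact congrArg ofConv h1

theorem mul_convIntegral_apply (α : WithConv (W.A ⊗[K] W.A →ₗ[K] K)) {y z : W.A}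
    (hy : y ∈ W.nichols) (hz : z ∈ W.nichols) :
    (α * W.convIntegral) (y ⊗ₜ z) = α (y ⊗ₜ z) := by
  rw [convIntegral, ← comp_convScal_mul]
  change integral K Γ ((convScal (MonoidAlgebra K Γ) α * box W.convProj W.convProj) (y ⊗ₜ z)) = _
  rw [W.convScal_mul_box_convProj_apply α hy hz, ← one_mul (algebraMap K _ _),
    ← map_one (MonoidAlgebra.of K Γ), integral_of_mul_algebraMap, integral_of_one, one_mul]

/-- Moving `φ` to the left past `π ∘ m` produces the factor `k`. On `R ⊗ R` the result is then a
scalar multiple of `k`, and `λ(k) = 0`. -/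
theorem mul_convIntegral_mul_apply (α : WithConv (W.A ⊗[K] W.A →ₗ[K] K))
    {φ : WithConv (W.A ⊗[K] W.A →ₗ[K] K)} {k : Γ} (hk : k ≠ 1)
    (hφ : HasDeg (box W.convProj W.convProj) φ k) {y z : W.A}
    (hy : y ∈ W.nichols) (hz : z ∈ W.nichols) :
    (α * W.convIntegral * φ) (y ⊗ₜ z) = 0 := by
  have h : convScal (MonoidAlgebra K Γ) α * box W.convProj W.convProj * convScal _ φ =
      MonoidAlgebra.of K Γ k • (convScal (MonoidAlgebra K Γ) (α * φ) *
        box W.convProj W.convProj) := by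
    rw [mul_assoc, hφ, mul_smul_comm, convScal_mul, mul_assoc]
  rw [convIntegral, ← comp_convScal_mul, ← comp_mul_convScal, toConv_ofConv, h]
  change integral K Γ (MonoidAlgebra.of K Γ k *
    (convScal (MonoidAlgebra K Γ) (α * φ) * box W.convProj W.convProj) (y ⊗ₜ z)) = _
  rw [W.convScal_mul_box_convProj_apply _ hy hz, integral_of_mul_algebraMap,
    integral_of_of_ne_one hk, zero_mul]

/-- The span of the forms on `A ⊗ A` of degrees `∏ j ∈ J, g_j ^ r_j`, for the nonempty sets `J` of
elements of the list `l`. -/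
def relDegSpan (l : List (Fin θ)) : Submodule K (WithConv (W.A ⊗[K] W.A →ₗ[K] K)) :=
  Submodule.span K {φ | ∃ J : Finset (Fin θ), J.Nonempty ∧ (∀ j ∈ J, j ∈ l) ∧
    HasDeg (box W.convProj W.convProj) φ (∏ j ∈ J, W.g j ^ W.r j)}

/-- The inverse is the product of the `1 - a_i η_i` in reverse order. As indices do not repeat, each
nonconstant term of its expansion has degree indexed by a nonempty set. -/
theorem exists_inverse_prod (a : Fin θ → K) (l : List (Fin θ)) (hl : l.Nodup) :
    ∃ β, (l.map fun i => 1 + a i • W.eta i).prod * β = 1 ∧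
      β * (l.map fun i => 1 + a i • W.eta i).prod = 1 ∧ β - 1 ∈ W.relDegSpan l := by
  induction l with
  | nil => exact ⟨1, by simp, by simp, by simp⟩
  | cons i l ih =>
    obtain ⟨hi, hl⟩ := List.nodup_cons.1 hl
    obtain ⟨β, h1, h2, h3⟩ := ih hl
    have hs : a i • W.eta i * a i • W.eta i = 0 := by
      rw [smul_mul_assoc, mul_smul_comm, eta_mul_eta, smul_zero, smul_zero]
    have hp : (1 + a i • W.eta i) * (1 - a i • W.eta i) = 1 := by
      rw [mul_sub, mul_one, add_mul, one_mul, hs]; abel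
    have hm : (1 - a i • W.eta i) * (1 + a i • W.eta i) = 1 := by
      rw [mul_add, mul_one, sub_mul, one_mul, hs]; abel
    refine ⟨β * (1 - a i • W.eta i), ?_, ?_, ?_⟩
    · rw [List.map_cons, List.prod_cons, mul_assoc, ← mul_assoc _ β, h1, one_mul, hp]
    · rw [List.map_cons, List.prod_cons, mul_assoc, ← mul_assoc _ (1 + a i • W.eta i), hm, one_mul,
        h2]
    · have e : β * (1 - a i • W.eta i) - 1 =
          (β - 1) - a i • ((β - 1) * W.eta i) - a i • W.eta i := by
        rw [mul_sub, mul_one, sub_mul, one_mul, smul_sub, mul_smul_comm]; abel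
      have hle : W.relDegSpan l ≤ W.relDegSpan (i :: l) := by
        refine Submodule.span_mono ?_
        rintro φ ⟨J, hJ, hJl, hφ⟩
        exact ⟨J, hJ, fun j hj => List.mem_cons_of_mem _ (hJl j hj), hφ⟩
      have hmul : ∀ φ ∈ W.relDegSpan l, φ * W.eta i ∈ W.relDegSpan (i :: l) := by
        intro φ hφ
        induction hφ using Submodule.span_induction with
        | mem φ hφ =>
          obtain ⟨J, hJ, hJl, hφ⟩ := hφ
          -- Since `i` does not occur in `l`, it is not in `J`, and multiplying by `η_i` contributes
          -- one new factor `g_i ^ r_i`.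
          refine Submodule.subset_span ⟨insert i J, Finset.insert_nonempty i J, ?_, ?_⟩
          · intro j hj
            rcases Finset.mem_insert.1 hj with rfl | hj
            exacts [List.mem_cons_self, List.mem_cons_of_mem _ (hJl j hj)]
          · rw [Finset.prod_insert fun h => hi (hJl i h), mul_comm]
            exact hφ.mul (W.hasDeg_eta i)
        | zero => rw [zero_mul]; exact zero_mem _
        | add φ ψ _ _ hφ hψ => rw [add_mul]; exact add_mem hφ hψ
        | smul c φ _ hφ => rw [smul_mul_assoc]; exact Submodule.smul_mem _ _ hφ
      have heta : W.eta i ∈ W.relDegSpan (i :: l) :=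
        Submodule.subset_span ⟨{i}, Finset.singleton_nonempty i, by simp, by
          rw [Finset.prod_singleton]; exact W.hasDeg_eta i⟩
      rw [e]
      exact sub_mem (sub_mem (hle h3) (Submodule.smul_mem _ _ (hmul _ h3)))
        (Submodule.smul_mem _ _ heta)

theorem alpha_eq {a : Fin θ → K} {I : Finset (Fin θ)} (hχ : ∀ i ∈ I, W.χ i ^ W.r i = 1) :
    W.alpha a I = ((I.sort (· ≤ ·)).map fun i => 1 + a i • W.eta i).prod := by
  rw [alpha]
  congr 1
  refine List.map_congr_left fun i hi => W.gamma_eq (hχ i ?_) (a i)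
  simpa using hi

end QuantumLinearSpace

end

theorem mainTheorem3 {K : Type*} [Field K] [CharZero K] {Γ : Type*} [CommGroup Γ] [Finite Γ] {θ : ℕ}
    (W : QuantumLinearSpace K Γ θ) (I : Finset (Fin θ)) (a : Fin θ → K)
    (hχ : ∀ i ∈ I, W.χ i ^ W.r i = 1)
    (hγ : ∀ i ∈ I, W.gamma i (a i) ≠ 1)
    (hg : ∀ J ⊆ I, J.Nonempty → ∏ j ∈ J, W.g j ^ W.r j ≠ 1) :
    (∀ i ∈ I, W.IsGamma i (a i) (W.gamma i (a i)).ofConv) ∧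
    IsUnit (W.alpha a I) ∧
    QuantumLinearSpace.integral K Γ ∘ₗ W.proj.toLinearMap ∘ₗ W.twistedMul (W.alpha a I) ∘ₗ
        W.nicholsIncl =
      (W.alpha a I).ofConv ∘ₗ W.nicholsIncl := by
  obtain ⟨β, h1, h2, h3⟩ := W.exists_inverse_prod a (I.sort (· ≤ ·)) (I.sort_nodup _)
  rw [← W.alpha_eq hχ] at h1 h2
  refine ⟨fun i hi => ?_, ⟨⟨W.alpha a I, β, h1, h2⟩, rfl⟩, ?_⟩
  · rw [W.gamma_eq (hχ i hi)]
    exact W.isGamma_one_add_smul_eta (hχ i hi) (a i)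
  -- As `α` is a unit, the inverse used in the twist is the genuine one and not the default `0`.
  · have hβ : Ring.inverse (W.alpha a I) = β := Ring.inverse_unit ⟨W.alpha a I, β, h1, h2⟩
    refine TensorProduct.ext' fun y z => ?_
    have h := LinearMap.congr_fun (W.integral_comp_twistedMul (W.alpha a I))
      (y.1 ⊗ₜ[K] z.1)
    refine h.trans ?_
    rw [hβ]
    -- This applies to `β - 1`: only the term `1` of the inverse contributes on `R ⊗ R`.
    have hker : ∀ φ ∈ W.relDegSpan (I.sort (· ≤ ·)),
        (W.alpha a I * W.convIntegral * φ) (y.1 ⊗ₜ[K] z.1) = 0 := by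
      intro φ hφ
      induction hφ using Submodule.span_induction with
      | mem φ hφ =>
        obtain ⟨J, hJ, hJI, hφ⟩ := hφ
        exact W.mul_convIntegral_mul_apply _
          (hg J (fun j hj => by simpa using hJI j hj) hJ) hφ y.2 z.2
      | zero => rw [mul_zero]; rfl
      | add φ ψ _ _ hφ hψ =>
        rw [mul_add, WithConv.ofConv_add, LinearMap.add_apply, hφ, hψ, add_zero]
      | smul c φ _ hφ => rw [mul_smul_comm, QuantumLinearSpace.conv_smul_apply, hφ, mul_zero]
    have e : W.alpha a I * W.convIntegral * β =
        W.alpha a I * W.convIntegral + W.alpha a I * W.convIntegral * (β - 1) := by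
      rw [mul_sub, mul_one]; abel
    rw [e, WithConv.ofConv_add, LinearMap.add_apply, hker _ h3, add_zero]
    exact W.mul_convIntegral_apply _ y.2 z.2
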